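/- Let $F$ be a field of characteristic $0$, let $q\in F$ be a primitive $l$-th root of unity with $l$ odd, and let $m,n,r\ge 0$. **Words and compositions.** For a letter $a\in\{1,\dots,m+n\}$ put $\hat a=0$ if $a\le m$ and $\hat a=1$ otherwise. Let $I$ be the set of words $\mathbf i=(i_1,\dots,i_r)$ in these letters; $W=\mathfrak S_r$, with basic transpositions $s_k=(k,k+1)$ and length function $\ell$, acts on the right by $\mathbf iw=(i_{w(1)},\dots,i_{w(r)})$. Let $\Lambda(m|n,r)$ be the set of compositions of $r$ into $m+n$ parts (zeros allowed). For $\lambda\in\Lambda(m|n,r)$ let $\mathbf i_\lambda$ be the weakly increasing word with $\lambda_a$ letters $a$, let $W_\lambda$ be the Young subgroup (the stabilizer of $\mathbf i_\lambda$), and let $W_{\lambda^{(0)}}$, $W_{\lambda^{(1)}}$ be the subgroups of $W_\lambda$ of permutations that move only places at which $\mathbf i_\lambda$ has an even, respectively odd, letter. For a subgroup $W'$ let $\mathcal D_{W'}$ be the set of shortest representatives of the cosets $W'w$, and write $W'^d=d^{-1}W'd$. Let $\mathcal D^\circ_{\lambda\mu}$ be the set of $d\in\mathcal D_{W_\lambda}\cap\mathcal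 D_{W_\mu}^{-1}$ with $W_{\lambda^{(0)}}^d\cap W_{\mu^{(1)}}=1=W_{\lambda^{(1)}}^d\cap W_{\mu^{(0)}}$, and write $W_{\lambda d\cap\mu}=W_\lambda^d\cap W_\mu$. **The $q$-Schur superalgebra.** Let $\mathcal H$ be the Hecke algebra of $W$ over $F$, generated by $\mathcal T_{s_k}$ ($1\le k<r$) subject to the braid relations and $\mathcal T_{s_k}^2=(q-q^{-1})\mathcal T_{s_k}+1$, and let $\mathcal T_w$ be the product of generators along a reduced expression of $w$. Let $V$ have basis $v_1,\dots,v_{m+n}$ and put $v_{\mathbf i}=v_{i_1}\otimes\cdots\otimes v_{i_r}$. Then $V^{\otimes r}$ is a right $\mathcal H$-module by $$v_{\mathbf i}\mathcal T_{s_k}=\begin{cases}(-1)^{\hat i_k\hat i_{k+1}}v_{\mathbf is_k}, & i_k<i_{k+1},\\ q\,v_{\mathbf i}, & i_k=i_{k+1}\le m,\\ -q^{-1}v_{\mathbf i}, & i_k=i_{k+1}>m,\\ (-1)^{\hat i_k\hat i_{k+1}}v_{\mathbf is_k}+(q-q^{-1})v_{\mathbf i}, & i_k>i_{k+1}.\end{cases}$$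 Let $\mathcal S_F(m|n,r)=\mathrm{End}_{\mathcal H}(V^{\otimes r})$, with endomorphisms acting and composed on the right. Let $e_{\mathbf i,\mathbf j}\in\mathrm{End}_F(V^{\otimes r})$ send $v_{\mathbf i}$ to $v_{\mathbf j}$ and all other $v_{\mathbf i'}$ to $0$, put $e_{\mu,\lambda d}=e_{\mathbf i_\mu,\mathbf i_\lambda d}$, and for $b\in\mathrm{End}_F(V^{\otimes r})$ let $N_{W,W'}(b)=\sum_{w\in\mathcal D_{W'}}\mathcal T_{w^{-1}}\,b\,\mathcal T_w$, the map $v\mapsto\sum_{w}((v\mathcal T_{w^{-1}})b)\mathcal T_w$. **The quantum matrix superalgebra.** Let $\mathcal A_q(m|n)$ be the $F$-algebra generated by $x_{ij}$, $1\le i,j\le m+n$, subject to 1. $x_{ij}^2=0$ if $\hat i+\hat j=1$; 2. $x_{ij}x_{ik}=(-1)^{(\hat i+\hat j)(\hat i+\hat k)}q^{(-1)^{\hat i+1}}x_{ik}x_{ij}$ for $j<k$; 3. $x_{ij}x_{kj}=(-1)^{(\hat i+\hat j)(\hat k+\hat j)}q^{(-1)^{\hat j+1}}x_{kj}x_{ij}$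 for $i<k$; 4. $x_{ij}x_{kh}=(-1)^{(\hat i+\hat j)(\hat k+\hat h)}x_{kh}x_{ij}$ for $i<k$, $j>h$; 5. $x_{ij}x_{kh}=(-1)^{(\hat i+\hat j)(\hat k+\hat h)}x_{kh}x_{ij}+(-1)^{\hat k\hat j+\hat k\hat h+\hat j\hat h}(q^{-1}-q)x_{ih}x_{kj}$ for $i<k$, $j<h$. For $\mathbf i,\mathbf j\in I$ put $x_{\mathbf i,\mathbf j}=x_{i_1j_1}\cdots x_{i_rj_r}$ and $x_{\mu,\lambda d}=x_{\mathbf i_\mu,\mathbf i_\lambda d}$, and let $\mathcal A_q(m|n,r)$ be the span of all $x_{\mathbf i,\mathbf j}$ with $\mathbf i,\mathbf j\in I$. Define $\delta:V^{\otimes r}\to\mathcal A_q(m|n,r)\otimes V^{\otimes r}$ by $$\delta(v_{\mathbf i})=\sum_{\mathbf j\in I}(-1)^{\sum_{1\le k<k'\le r}\hat j_k(\hat j_{k'}+\hat i_{k'})}\,x_{\mathbf i,\mathbf j}\otimes v_{\mathbf j},$$ and for $f\in\mathcal A_q(m|n,r)^*$ put $v\cdot f=(f\otimes\mathrm{id})\delta(v)$.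 **Theorem.** (a) $\mathcal A_q(m|n,r)$ is a coalgebra with the comultiplication and counit $$\Delta(x_{\mathbf i,\mathbf j})=\sum_{\mathbf p\in I}(-1)^{\sum_{k<k'}(\hat p_k+\hat j_k)(\hat i_{k'}+\hat p_{k'})}x_{\mathbf i,\mathbf p}\otimes x_{\mathbf p,\mathbf j},\qquad \varepsilon(x_{\mathbf i,\mathbf j})=\delta_{\mathbf i,\mathbf j}$$ (obtained from $\Delta(x_{ij})=\sum_p x_{ip}\otimes x_{pj}$, $\varepsilon(x_{ij})=\delta_{ij}$ by super multiplicativity), and $f\mapsto(v\mapsto v\cdot f)$ is an isomorphism of algebras from the dual algebra $\mathcal A_q(m|n,r)^*$ onto $\mathcal S_F(m|n,r)$. The elements $x_{\mu,\lambda d}$, indexed by the triples $(\lambda,\mu,d)$ with $\lambda,\mu\in\Lambda(m|n,r)$ and $d\in\mathcal D^\circ_{\lambda\mu}$, form a basis of $\mathcal A_q(m|n,r)$; let $x^*_{\mu,\lambda d}$ denote the elements of the dual basis. (b) Identify $\mathcal A_q(m|n,r)^*$ with $\mathcal S_F(m|n,r)$ by this isomorphism. Then for all $\lambda,\mu\in\Lambda(m|n,r)$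 and $d\in\mathcal D^\circ_{\lambda\mu}$, with $W_\nu=W_{\lambda d\cap\mu}$, $$N_{W,W_\nu}(e_{\mu,\lambda d})=(-1)^{\sum_{1\le k<k'\le r}\widehat{(\mathbf i_\lambda d)_k}\left(\widehat{(\mathbf i_\lambda d)_{k'}}+\widehat{(\mathbf i_\mu)_{k'}}\right)}\,x^*_{\mu,\lambda d}.$$ -/

import Mathlib

open scoped TensorProduct

noncomputable section

namespace QSuper

/-! ### The symmetric group on `r` letters

Letters and places are numbered from `0`.  The product `w * u` in `Equiv.Perm (Fin r)` is
`k ↦ w (u k)`, so `i ↦ i ∘ w` is a right action on words `i`. -/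

/-- The basic transposition `s_k = (k, k + 1)`. -/
def simpleRefl {r : ℕ} (k : Fin (r - 1)) : Equiv.Perm (Fin r) :=
  Equiv.swap ⟨k.1, by omega⟩ ⟨k.1 + 1, by omega⟩

/-- The product `s_{k_1} ⋯ s_{k_t}` of a word in the basic transpositions. -/
def wordProd {r : ℕ} (L : List (Fin (r - 1))) : Equiv.Perm (Fin r) :=
  (L.map simpleRefl).prod

theorem exists_wordProd {r : ℕ} (w : Equiv.Perm (Fin r)) :
    ∃ L : List (Fin (r - 1)), wordProd L = w := by
  obtain _ | r := r
  · exact ⟨[], Subsingleton.elim _ _⟩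
  · have h : w ∈ Submonoid.closure
        (Set.range fun i : Fin r => Equiv.swap i.castSucc i.succ) := by
      rw [Equiv.Perm.mclosure_swap_castSucc_succ]; trivial
    induction h using Submonoid.closure_induction with
    | mem x hx =>
      obtain ⟨i, rfl⟩ := hx
      refine ⟨[i], ?_⟩
      simp [wordProd, simpleRefl]
      rfl
    | one => exact ⟨[], rfl⟩
    | mul x y _ _ hx hy =>
      obtain ⟨L, rfl⟩ := hx
      obtain ⟨M, rfl⟩ := hy
      exact ⟨L ++ M, by simp [wordProd]⟩

/-- The length function with respect to the basic transpositions. -/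
def len {r : ℕ} (w : Equiv.Perm (Fin r)) : ℕ :=
  sInf {t | ∃ L : List (Fin (r - 1)), wordProd L = w ∧ L.length = t}

theorem exists_reducedWord {r : ℕ} (w : Equiv.Perm (Fin r)) :
    ∃ L : List (Fin (r - 1)), wordProd L = w ∧ L.length = len w := by
  obtain ⟨L, hL⟩ := exists_wordProd w
  exact Nat.sInf_mem (s := {t | ∃ L : List (Fin (r - 1)), wordProd L = w ∧ L.length = t})
    ⟨L.length, L, hL, rfl⟩

/-- A reduced expression of `w`. -/
def reducedWord {r : ℕ} (w : Equiv.Perm (Fin r)) : List (Fin (r - 1)) :=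
  (exists_reducedWord w).choose

/-- The shortest representatives of the right cosets `W' w` of a subgroup `W'`. -/
def distinguished {r : ℕ} (W' : Subgroup (Equiv.Perm (Fin r))) : Set (Equiv.Perm (Fin r)) :=
  {w | ∀ u ∈ W', len w ≤ len (u * w)}

/-- The conjugate `W'^d = d⁻¹ W' d`. -/
def conjBy {r : ℕ} (W' : Subgroup (Equiv.Perm (Fin r))) (d : Equiv.Perm (Fin r)) :
    Subgroup (Equiv.Perm (Fin r)) :=
  W'.map (MulAut.conj d⁻¹).toMonoidHom

/-! ### Compositions `Λ(m|n, r)` and their Young subgroups -/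

/-- The parity of a letter: the first `m` letters are even (`0`), the last `n` are odd (`1`). -/
def parity {m n : ℕ} (a : Fin (m + n)) : ℕ := if a.1 < m then 0 else 1

/-- Compositions of `r` into `m + n` parts, parts equal to `0` allowed. -/
def Lam (m n r : ℕ) : Type := {lam : Fin (m + n) → ℕ // ∑ a, lam a = r}

/-- The word `i_λ`, in which each letter `a` occurs `λ_a` times, in weakly increasing order. -/
def Lam.word {m n r : ℕ} (lam : Lam m n r) : Fin r → Fin (m + n) :=
  fun k => (finSigmaFinEquiv.symm (Fin.cast lam.2.symm k)).1

/-- The Young subgroup `W_λ`: permutations leaving invariant every block of consecutive places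
on which the word `i_λ` is constant. -/
def Lam.young {m n r : ℕ} (lam : Lam m n r) : Subgroup (Equiv.Perm (Fin r)) where
  carrier := {w | ∀ k, lam.word (w k) = lam.word k}
  mul_mem' {a b} ha hb k := by
    have h1 := ha (b k)
    have h2 := hb k
    simpa [h2] using h1
  one_mem' k := rfl
  inv_mem' {a} ha k := by
    have h1 := ha (a⁻¹ k)
    simpa using h1.symm

/-- The even (`e = 0`) or odd (`e = 1`) part `W_{λ^{(e)}}` of `W_λ`: the elements of `W_λ` moving
only places that lie in blocks of parity `e`. -/
def Lam.youngPart {m n r : ℕ} (lam : Lam m n r) (e : ℕ) : Subgroup (Equiv.Perm (Fin r)) where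
  carrier := {w | w ∈ lam.young ∧ ∀ k, parity (lam.word k) ≠ e → w k = k}
  mul_mem' {a b} ha hb := ⟨mul_mem ha.1 hb.1, fun k hk => by
    have h2 := hb.2 k hk
    have h1 := ha.2 k hk
    simp [h2, h1]⟩
  one_mem' := ⟨one_mem _, fun _ _ => rfl⟩
  inv_mem' {a} ha := ⟨inv_mem ha.1, fun k hk => by
    have h1 := ha.2 k hk
    exact Equiv.Perm.inv_eq_iff_eq.mpr h1.symm⟩

/-- `𝒟°_{λμ}`: the distinguished `W_λ`-`W_μ` double coset representatives `d` with
`W_{λ^{(0)}}^d ∩ W_{μ^{(1)}} = 1 = W_{λ^{(1)}}^d ∩ W_{μ^{(0)}}`. -/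
def DCirc {m n r : ℕ} (lam mu : Lam m n r) : Set (Equiv.Perm (Fin r)) :=
  {d | d ∈ distinguished lam.young ∧ d⁻¹ ∈ distinguished mu.young ∧
    conjBy (lam.youngPart 0) d ⊓ mu.youngPart 1 = ⊥ ∧
    conjBy (lam.youngPart 1) d ⊓ mu.youngPart 0 = ⊥}

/-- Triples `(λ, μ, d)` with `d ∈ 𝒟°_{λμ}`. -/
structure Triple (m n r : ℕ) where
  lam : Lam m n r
  mu : Lam m n r
  d : Equiv.Perm (Fin r)
  mem : d ∈ DCirc lam mu

/-- The word `i_λ d`. -/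
def Triple.colWord {m n r : ℕ} (t : Triple m n r) : Fin r → Fin (m + n) := t.lam.word ∘ t.d

/-- The word `i_μ`. -/
def Triple.rowWord {m n r : ℕ} (t : Triple m n r) : Fin r → Fin (m + n) := t.mu.word

/-- The parabolic subgroup `W_{λd ∩ μ} = W_λ^d ∩ W_μ`. -/
def Triple.stab {m n r : ℕ} (t : Triple m n r) : Subgroup (Equiv.Perm (Fin r)) :=
  conjBy t.lam.young t.d ⊓ t.mu.young

/-! ### The Hecke algebra of `𝔖_r` -/

/-- Defining relations of the Hecke algebra with normalized generators `𝒯_{s_k}`. -/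
inductive HeckeRel {F : Type*} [Field F] (q : Fˣ) (r : ℕ) :
    FreeAlgebra F (Fin (r - 1)) → FreeAlgebra F (Fin (r - 1)) → Prop
  | quadratic (k : Fin (r - 1)) :
      HeckeRel q r (FreeAlgebra.ι F k * FreeAlgebra.ι F k)
        (((q : F) - (q : F)⁻¹) • FreeAlgebra.ι F k + 1)
  | braid (k j : Fin (r - 1)) (h : k.1 + 1 = j.1) :
      HeckeRel q r (FreeAlgebra.ι F k * FreeAlgebra.ι F j * FreeAlgebra.ι F k)
        (FreeAlgebra.ι F j * FreeAlgebra.ι F k * FreeAlgebra.ι F j)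
  | far (k j : Fin (r - 1)) (h : k.1 + 1 < j.1) :
      HeckeRel q r (FreeAlgebra.ι F k * FreeAlgebra.ι F j)
        (FreeAlgebra.ι F j * FreeAlgebra.ι F k)

/-- The Hecke algebra of the symmetric group on `r` letters. -/
abbrev Hecke {F : Type*} [Field F] (q : Fˣ) (r : ℕ) : Type _ := RingQuot (HeckeRel q r)

/-- The generator `𝒯_{s_k}`. -/
def Hecke.gen {F : Type*} [Field F] (q : Fˣ) {r : ℕ} (k : Fin (r - 1)) : Hecke q r :=
  RingQuot.mkAlgHom F (HeckeRel q r) (FreeAlgebra.ι F k)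

/-- The standard element `𝒯_w`, the product of the generators along a reduced expression. -/
def Hecke.T {F : Type*} [Field F] (q : Fˣ) {r : ℕ} (w : Equiv.Perm (Fin r)) : Hecke q r :=
  ((reducedWord w).map (Hecke.gen q)).prod

/-! ### The tensor superspace -/

/-- `V(m|n)^{⊗ r}`, where `V(m|n)` has basis `v_a`, `a : Fin (m + n)`. -/
abbrev TensorSpace (F : Type*) [Field F] (m n r : ℕ) : Type _ :=
  ⨂[F] _ : Fin r, (Fin (m + n) → F)

/-- The basis of the tensors `v_i = v_{i_1} ⊗ ⋯ ⊗ v_{i_r}`. -/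
def vBasis (F : Type*) [Field F] (m n r : ℕ) :
    Module.Basis (Fin r → Fin (m + n)) F (TensorSpace F m n r) :=
  Basis.piTensorProduct fun _ => Pi.basisFun F (Fin (m + n))

/-- The operator `v ↦ v 𝒯_{s_k}` on the tensor superspace. -/
def genOp {F : Type*} [Field F] (q : Fˣ) (m n : ℕ) {r : ℕ} (k : Fin (r - 1)) :
    Module.End F (TensorSpace F m n r) :=
  (vBasis F m n r).constr F fun i =>
    let a := i ⟨k.1, by omega⟩
    let b := i ⟨k.1 + 1, by omega⟩
    if a < b then (-1 : F) ^ (parity a * parity b) • vBasis F m n r (i ∘ simpleRefl k)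
    else if a = b then
      (if a.1 < m then (q : F) else -(q : F)⁻¹) • vBasis F m n r i
    else (-1 : F) ^ (parity a * parity b) • vBasis F m n r (i ∘ simpleRefl k)
      + ((q : F) - (q : F)⁻¹) • vBasis F m n r i


section Relations

variable {F : Type*} [Field F] (q : Fˣ) {m n r : ℕ}

/-- The coefficient of `v_{i s_k}` in `v_i 𝒯_{s_k}`. -/
def offCoef (F : Type*) [Field F] {m n : ℕ} (a b : Fin (m + n)) : F :=
  if a = b then 0 else (-1 : F) ^ (parity a * parity b)

/-- The coefficient of `v_i` in `v_i 𝒯_{s_k}`. -/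
def diagCoef {m n : ℕ} (a b : Fin (m + n)) : F :=
  if a < b then 0 else if a = b then (if a.1 < m then (q : F) else -(q : F)⁻¹)
  else (q : F) - (q : F)⁻¹

theorem genOp_basis (k : Fin (r - 1)) (i : Fin r → Fin (m + n)) :
    genOp q m n k (vBasis F m n r i) =
      offCoef F (i ⟨k.1, by omega⟩) (i ⟨k.1 + 1, by omega⟩) • vBasis F m n r (i ∘ simpleRefl k)
      + diagCoef q (i ⟨k.1, by omega⟩) (i ⟨k.1 + 1, by omega⟩) • vBasis F m n r i := by
  simp only [genOp, Module.Basis.constr_basis, offCoef, diagCoef]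
  split_ifs with h1 h2 <;> simp_all

theorem comp_simpleRefl_self (k : Fin (r - 1)) (i : Fin r → Fin (m + n))
    (h : i ⟨k.1, by omega⟩ = i ⟨k.1 + 1, by omega⟩) : i ∘ simpleRefl k = i := by
  funext x
  simp only [Function.comp, simpleRefl, Equiv.swap_apply_def]
  split_ifs with h1 h2
  · rw [h1, h]
  · rw [h2, h]
  · rfl

theorem offCoef_sq (a b : Fin (m + n)) (h : a ≠ b) :
    offCoef F a b * offCoef F b a = 1 := by
  rw [offCoef, offCoef, if_neg h, if_neg h.symm, mul_comm (parity b), ← pow_add, ← two_mul,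
    pow_mul]
  simp

theorem genOp_quadratic (k : Fin (r - 1)) :
    genOp q m n k * genOp q m n k = ((q : F) - (q : F)⁻¹) • genOp q m n k + 1 := by
  refine (vBasis F m n r).ext fun i => ?_
  have hq : (q : F) ≠ 0 := q.ne_zero
  have e1 : (i ∘ simpleRefl k) ⟨k.1, by omega⟩ = i ⟨k.1 + 1, by omega⟩ := by
    simp [simpleRefl]
  have e2 : (i ∘ simpleRefl k) ⟨k.1 + 1, by omega⟩ = i ⟨k.1, by omega⟩ := by
    simp [simpleRefl]
  have e3 : (i ∘ simpleRefl k) ∘ simpleRefl k = i := by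
    funext x; simp [simpleRefl]
  simp only [Module.End.mul_apply, genOp_basis, map_add, map_smul, e1, e2, e3,
    LinearMap.add_apply, LinearMap.smul_apply, Module.End.one_apply, smul_add, smul_smul]
  have e4 := comp_simpleRefl_self k i
  generalize i ⟨k.1, by omega⟩ = a at *
  generalize i ⟨k.1 + 1, by omega⟩ = b at *
  rcases lt_trichotomy a b with h | h | h
  · rw [offCoef_sq a b h.ne]
    simp only [diagCoef, h, h.not_gt, h.ne', if_true, if_false]
    module
  · rw [e4 h]; subst h
    simp only [offCoef, diagCoef, lt_irrefl, if_true, if_false]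
    split_ifs <;> (match_scalars; field_simp; ring)
  · rw [offCoef_sq a b h.ne']
    simp only [diagCoef, h, h.not_gt, h.ne', if_true, if_false]
    module

theorem genOp_far (k j : Fin (r - 1)) (h : k.1 + 1 < j.1) :
    genOp q m n k * genOp q m n j = genOp q m n j * genOp q m n k := by
  refine (vBasis F m n r).ext fun i => ?_
  have e1 : (i ∘ simpleRefl k) ⟨j.1, by omega⟩ = i ⟨j.1, by omega⟩ := by
    simp only [simpleRefl, Function.comp]
    rw [Equiv.swap_apply_of_ne_of_ne] <;> simp [Fin.ext_iff] <;> omega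
  have e2 : (i ∘ simpleRefl k) ⟨j.1 + 1, by omega⟩ = i ⟨j.1 + 1, by omega⟩ := by
    simp only [simpleRefl, Function.comp]
    rw [Equiv.swap_apply_of_ne_of_ne] <;> simp [Fin.ext_iff] <;> omega
  have e3 : (i ∘ simpleRefl j) ⟨k.1, by omega⟩ = i ⟨k.1, by omega⟩ := by
    simp only [simpleRefl, Function.comp]
    rw [Equiv.swap_apply_of_ne_of_ne] <;> simp [Fin.ext_iff] <;> omega
  have e4 : (i ∘ simpleRefl j) ⟨k.1 + 1, by omega⟩ = i ⟨k.1 + 1, by omega⟩ := by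
    simp only [simpleRefl, Function.comp]
    rw [Equiv.swap_apply_of_ne_of_ne] <;> simp [Fin.ext_iff] <;> omega
  have e5 : (i ∘ simpleRefl j) ∘ simpleRefl k = (i ∘ simpleRefl k) ∘ simpleRefl j := by
    funext x
    simp only [Function.comp, simpleRefl, Equiv.swap_apply_def, Fin.ext_iff]
    congr 1
    grind
  simp only [Module.End.mul_apply, genOp_basis, map_add, map_smul, e1, e2, e3, e4, e5]
  module

theorem braid_core {M : Type*} [AddCommGroup M] [Module F M] (a b c : Fin (m + n))
    (e s t st ts w : M)
    (hab : a = b → s = e ∧ st = t ∧ w = ts) (hbc : b = c → t = e ∧ ts = s ∧ w = st)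
    (hac : a = c → st = s ∧ ts = t ∧ w = e) :
    offCoef F a b • (offCoef F a c • (offCoef F b c • w + diagCoef q b c • st)
        + diagCoef q a c • (offCoef F b a • e + diagCoef q b a • s))
      + diagCoef q a b • (offCoef F b c • (offCoef F a c • ts + diagCoef q a c • t)
        + diagCoef q b c • (offCoef F a b • s + diagCoef q a b • e)) =
    offCoef F b c • (offCoef F a c • (offCoef F a b • w + diagCoef q a b • ts)
        + diagCoef q a c • (offCoef F c b • e + diagCoef q c b • t))
      + diagCoef q b c • (offCoef F a b • (offCoef F a c • st + diagCoef q a c • s)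
        + diagCoef q a b • (offCoef F b c • t + diagCoef q b c • e)) := by
  have hq : (q : F) ≠ 0 := q.ne_zero
  by_cases h1 : a = b
  · obtain ⟨rfl, rfl, rfl⟩ := hab h1
    subst h1
    by_cases h2 : a = c
    · subst h2
      obtain ⟨rfl, h3, -⟩ := hbc rfl
      subst h3
      module
    · rcases lt_or_gt_of_ne h2 with h | h
      · have := offCoef_sq (F := F) a c h2
        have hz : offCoef F a a = 0 := by simp [offCoef]
        simp only [hz]
        have h5 : diagCoef q a c = 0 := by simp [diagCoef, h]
        rw [h5]; module
      · have := offCoef_sq (F := F) a c h2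
        have hz : offCoef F a a = 0 := by simp [offCoef]
        have h5 : diagCoef q a c = (q : F) - (q : F)⁻¹ := by
          simp only [diagCoef, h.not_gt, h2, if_false]
        have h6 : diagCoef q c a = 0 := by simp [diagCoef, h]
        have h7 : diagCoef q a a * diagCoef q a a
            = ((q : F) - (q : F)⁻¹) * diagCoef q a a + 1 := by
          simp only [diagCoef, lt_irrefl, if_false, if_true]
          split_ifs <;> (field_simp; ring)
        simp only [hz, h5, h6]
        match_scalars <;> (first
          | ring1
          | linear_combination ((q : F) - (q : F)⁻¹) * h7 - ((q : F) - (q : F)⁻¹) * this)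
  by_cases h2 : b = c
  · obtain ⟨rfl, rfl, rfl⟩ := hbc h2
    subst h2
    have hz : offCoef F b b = 0 := by simp [offCoef]
    have := offCoef_sq (F := F) a b h1
    have h7 : diagCoef q b b * diagCoef q b b
        = ((q : F) - (q : F)⁻¹) * diagCoef q b b + 1 := by
      simp only [diagCoef, lt_irrefl, if_false, if_true]
      split_ifs <;> (field_simp; ring)
    rcases lt_or_gt_of_ne h1 with h | h
    · have h5 : diagCoef q a b = 0 := by simp [diagCoef, h]
      simp only [hz, h5]; module
    · have h5 : diagCoef q a b = (q : F) - (q : F)⁻¹ := by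
        simp only [diagCoef, h.not_gt, h1, if_false]
      have h6 : diagCoef q b a = 0 := by simp [diagCoef, h]
      simp only [hz, h5, h6]
      match_scalars <;> (first
          | ring1
          | linear_combination ((q : F) - (q : F)⁻¹) * h7 - ((q : F) - (q : F)⁻¹) * this
          | linear_combination ((q : F) - (q : F)⁻¹) * this - ((q : F) - (q : F)⁻¹) * h7)
  have f1 := offCoef_sq (F := F) a b h1
  have f2 := offCoef_sq (F := F) b c h2
  by_cases h3 : a = c
  · obtain ⟨rfl, rfl, rfl⟩ := hac h3
    subst h3
    have hz : offCoef F a a = 0 := by simp [offCoef]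
    have h7 : diagCoef q a a * diagCoef q a a
        = ((q : F) - (q : F)⁻¹) * diagCoef q a a + 1 := by
      simp only [diagCoef, lt_irrefl, if_false, if_true]
      split_ifs <;> (field_simp; ring)
    rcases lt_or_gt_of_ne h1 with h | h
    · have h5 : diagCoef q a b = 0 := by simp [diagCoef, h]
      have h6 : diagCoef q b a = (q : F) - (q : F)⁻¹ := by
        simp only [diagCoef, h.not_gt, h.ne', if_false]
      simp only [hz, h5, h6]
      match_scalars <;> ring1
    · have h5 : diagCoef q b a = 0 := by simp [diagCoef, h]
      have h6 : diagCoef q a b = (q : F) - (q : F)⁻¹ := by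
        simp only [diagCoef, h.not_gt, h.ne', if_false]
      simp only [hz, h5, h6]
      match_scalars <;> ring1
  have g : ∀ x y : Fin (m + n), x ≠ y →
      diagCoef q x y = if x < y then 0 else (q : F) - (q : F)⁻¹ := by
    intro x y hxy; simp [diagCoef, hxy]
  simp only [g a b h1, g b c h2, g a c h3, g b a (Ne.symm h1), g c b (Ne.symm h2)]
  split_ifs <;> first
    | omega
    | module
    | (match_scalars <;> (first
        | ring1
        | linear_combination ((q : F) - (q : F)⁻¹) * f1 - ((q : F) - (q : F)⁻¹) * f2))

theorem genOp_braid (k j : Fin (r - 1)) (h : k.1 + 1 = j.1) :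
    genOp q m n k * genOp q m n j * genOp q m n k =
      genOp q m n j * genOp q m n k * genOp q m n j := by
  refine (vBasis F m n r).ext fun i => ?_
  obtain ⟨j, hj⟩ := j
  simp only at h
  subst h
  have p0 : k.1 < r := by omega
  have p1 : k.1 + 1 < r := by omega
  have p2 : k.1 + 1 + 1 < r := by omega
  set s := simpleRefl k with hs
  set t := simpleRefl (⟨k.1 + 1, hj⟩ : Fin (r - 1)) with ht
  have s0 : s ⟨k.1, p0⟩ = ⟨k.1 + 1, p1⟩ := by simp [hs, simpleRefl]
  have s1 : s ⟨k.1 + 1, p1⟩ = ⟨k.1, p0⟩ := by simp [hs, simpleRefl]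
  have s2 : s ⟨k.1 + 1 + 1, p2⟩ = ⟨k.1 + 1 + 1, p2⟩ := by
    rw [hs, simpleRefl, Equiv.swap_apply_of_ne_of_ne] <;> simp [Fin.ext_iff] <;> omega
  have t0 : t ⟨k.1, p0⟩ = ⟨k.1, p0⟩ := by
    rw [ht, simpleRefl, Equiv.swap_apply_of_ne_of_ne] <;> simp [Fin.ext_iff] <;> omega
  have t1 : t ⟨k.1 + 1, p1⟩ = ⟨k.1 + 1 + 1, p2⟩ := by simp [ht, simpleRefl]
  have t2 : t ⟨k.1 + 1 + 1, p2⟩ = ⟨k.1 + 1, p1⟩ := by simp [ht, simpleRefl]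
  have ss : ∀ f : Fin r → Fin (m + n), (f ∘ s) ∘ s = f := by
    intro f; funext x; simp [hs, simpleRefl]
  have tt : ∀ f : Fin r → Fin (m + n), (f ∘ t) ∘ t = f := by
    intro f; funext x; simp [ht, simpleRefl]
  have sts : ((i ∘ s) ∘ t) ∘ s = ((i ∘ t) ∘ s) ∘ t := by
    have hst : s * t * s = t * s * t := by
      ext x
      by_cases h0 : x = ⟨k.1, p0⟩
      · subst h0; simp [s0, s1, s2, t0, t1, t2]
      by_cases h1 : x = ⟨k.1 + 1, p1⟩
      · subst h1; simp [s0, s1, s2, t0, t1, t2]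
      by_cases h2 : x = ⟨k.1 + 1 + 1, p2⟩
      · subst h2; simp [s0, s1, s2, t0, t1, t2]
      have hsx : s x = x := by
        rw [hs, simpleRefl, Equiv.swap_apply_of_ne_of_ne] <;> assumption
      have htx : t x = x := by
        rw [ht, simpleRefl, Equiv.swap_apply_of_ne_of_ne] <;> assumption
      simp [hsx, htx]
    funext x
    exact congrArg (fun g : Equiv.Perm (Fin r) => i (g x)) hst
  have es : i ⟨k.1, p0⟩ = i ⟨k.1 + 1, p1⟩ → i ∘ s = i :=
    comp_simpleRefl_self k i
  have et : i ⟨k.1 + 1, p1⟩ = i ⟨k.1 + 1 + 1, p2⟩ → i ∘ t = i :=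
    comp_simpleRefl_self ⟨k.1 + 1, hj⟩ i
  have est : i ⟨k.1, p0⟩ = i ⟨k.1 + 1 + 1, p2⟩ → (i ∘ s) ∘ t = i ∘ s := by
    intro h; apply comp_simpleRefl_self; simp [s1, s2, h]
  have ets : i ⟨k.1, p0⟩ = i ⟨k.1 + 1 + 1, p2⟩ → (i ∘ t) ∘ s = i ∘ t := by
    intro h; apply comp_simpleRefl_self; simp [t0, t1, h]
  simp only [Module.End.mul_apply, genOp_basis, map_add, map_smul, ← hs, ← ht,
    Function.comp_apply, s0, s1, s2, t0, t1, t2, ss, tt, sts]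
  refine braid_core q _ _ _ _ _ _ _ _ _ ?_ ?_ ?_
  · intro h
    rw [es h, ← sts, es h]; simp
  · intro h
    refine ⟨by rw [et h], ?_, ?_⟩
    · rw [et h]
    · rw [← sts] ; rw [sts, et h]
  · intro h
    rw [est h, ← sts, est h, ets h, ss]; simp

end Relations

/-- The right action of the Hecke algebra on the tensor superspace, as an algebra homomorphism
into the opposite of the endomorphism algebra. -/
def heckeRep {F : Type*} [Field F] (q : Fˣ) (m n r : ℕ) :
    Hecke q r →ₐ[F] (Module.End F (TensorSpace F m n r))ᵐᵒᵖ :=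
  RingQuot.liftAlgHom F
    ⟨FreeAlgebra.lift F fun k => MulOpposite.op (genOp q m n k), by
      intro x y h
      induction h with
      | quadratic k =>
        simp only [map_mul, map_add, map_smul, map_one, FreeAlgebra.lift_ι_apply,
          ← MulOpposite.op_mul, genOp_quadratic]
        simp
      | braid k j h =>
        simp only [map_mul, FreeAlgebra.lift_ι_apply, ← MulOpposite.op_mul]
        rw [← mul_assoc, ← mul_assoc, genOp_braid q k j h]
      | far k j h =>
        simp only [map_mul, FreeAlgebra.lift_ι_apply, ← MulOpposite.op_mul]
        rw [genOp_far q k j h]⟩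

/-- The operator `v ↦ v h`, for `h` in the Hecke algebra. -/
def act {F : Type*} [Field F] {q : Fˣ} (m n : ℕ) {r : ℕ} (h : Hecke q r) :
    Module.End F (TensorSpace F m n r) :=
  (heckeRep q m n r h).unop

theorem act_gen {F : Type*} [Field F] (q : Fˣ) (m n : ℕ) {r : ℕ} (k : Fin (r - 1)) :
    act m n (Hecke.gen q k) = genOp q m n k := by
  simp [act, heckeRep, Hecke.gen]

/-- The `q`-Schur superalgebra `𝒮_F(m|n, r) = End_{ℋ_F}(V(m|n)^{⊗ r})`, the endomorphisms
commuting with the action of the Hecke algebra.  Its product here is composition of operators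
written on the left, `(f * g) v = f (g v)`. -/
def schurSuper {F : Type*} [Field F] (q : Fˣ) (m n r : ℕ) :
    Subalgebra F (Module.End F (TensorSpace F m n r)) :=
  Subalgebra.centralizer F (Set.range fun h : Hecke q r => act m n h)

/-- The matrix unit `e_{i,j}`, sending `v_i` to `v_j` and every other basis tensor to `0`. -/
def matUnit (F : Type*) [Field F] {m n r : ℕ} (i j : Fin r → Fin (m + n)) :
    Module.End F (TensorSpace F m n r) :=
  (vBasis F m n r).constr F fun i' => if i' = i then vBasis F m n r j else 0

open Classical in
/-- The relative norm `N_{W,W'}(b) = ∑ 𝒯_{w⁻¹} b 𝒯_w`, over the shortest representatives `w` of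
the right cosets of `W'`: the operator `v ↦ ∑ ((v 𝒯_{w⁻¹}) b) 𝒯_w`. -/
def relNorm {F : Type*} [Field F] (q : Fˣ) {m n r : ℕ} (W' : Subgroup (Equiv.Perm (Fin r)))
    (b : Module.End F (TensorSpace F m n r)) : Module.End F (TensorSpace F m n r) :=
  ∑ w ∈ Finset.univ.filter (fun w : Equiv.Perm (Fin r) => w ∈ distinguished W'),
    act m n (Hecke.T q w) ∘ₗ b ∘ₗ act m n (Hecke.T q w⁻¹)

/-! ### The quantum matrix superalgebra -/

/-- The defining relations of `𝒜_q(m|n)`. -/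
inductive MatRel {F : Type*} [Field F] (q : Fˣ) (m n : ℕ) :
    FreeAlgebra F (Fin (m + n) × Fin (m + n)) → FreeAlgebra F (Fin (m + n) × Fin (m + n)) → Prop
  | odd_sq (i j : Fin (m + n)) (h : parity i + parity j = 1) :
      MatRel q m n (FreeAlgebra.ι F (i, j) * FreeAlgebra.ι F (i, j)) 0
  | row (i j k : Fin (m + n)) (h : j < k) :
      MatRel q m n (FreeAlgebra.ι F (i, j) * FreeAlgebra.ι F (i, k))
        (((-1 : F) ^ ((parity i + parity j) * (parity i + parity k)) *
          (q : F) ^ ((-1 : ℤ) ^ (parity i + 1))) •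
          (FreeAlgebra.ι F (i, k) * FreeAlgebra.ι F (i, j)))
  | col (i j k : Fin (m + n)) (h : i < k) :
      MatRel q m n (FreeAlgebra.ι F (i, j) * FreeAlgebra.ι F (k, j))
        (((-1 : F) ^ ((parity i + parity j) * (parity k + parity j)) *
          (q : F) ^ ((-1 : ℤ) ^ (parity j + 1))) •
          (FreeAlgebra.ι F (k, j) * FreeAlgebra.ι F (i, j)))
  | anti (i j k l : Fin (m + n)) (h : i < k) (h' : l < j) :
      MatRel q m n (FreeAlgebra.ι F (i, j) * FreeAlgebra.ι F (k, l))
        ((-1 : F) ^ ((parity i + parity j) * (parity k + parity l)) •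
          (FreeAlgebra.ι F (k, l) * FreeAlgebra.ι F (i, j)))
  | main (i j k l : Fin (m + n)) (h : i < k) (h' : j < l) :
      MatRel q m n (FreeAlgebra.ι F (i, j) * FreeAlgebra.ι F (k, l))
        ((-1 : F) ^ ((parity i + parity j) * (parity k + parity l)) •
          (FreeAlgebra.ι F (k, l) * FreeAlgebra.ι F (i, j)) +
        ((-1 : F) ^ (parity k * parity j + parity k * parity l + parity j * parity l) *
          ((q : F)⁻¹ - (q : F))) • (FreeAlgebra.ι F (i, l) * FreeAlgebra.ι F (k, j)))

/-- The quantum matrix superalgebra `𝒜_q(m|n)`. -/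
abbrev QMat {F : Type*} [Field F] (q : Fˣ) (m n : ℕ) : Type _ := RingQuot (MatRel q m n)

/-- The generator `x_{ij}`. -/
def QMat.x {F : Type*} [Field F] (q : Fˣ) {m n : ℕ} (i j : Fin (m + n)) : QMat q m n :=
  RingQuot.mkAlgHom F (MatRel q m n) (FreeAlgebra.ι F (i, j))

/-- The monomial `x_{i,j} = x_{i_1 j_1} ⋯ x_{i_r j_r}`. -/
def QMat.mono {F : Type*} [Field F] (q : Fˣ) {m n r : ℕ} (i j : Fin r → Fin (m + n)) :
    QMat q m n :=
  (List.ofFn fun k => QMat.x q (i k) (j k)).prod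

/-- The homogeneous component `𝒜_q(m|n, r)` of degree `r`. -/
def QMat.homog {F : Type*} [Field F] (q : Fˣ) (m n r : ℕ) : Submodule F (QMat q m n) :=
  Submodule.span F (Set.range fun p : (Fin r → Fin (m + n)) × (Fin r → Fin (m + n)) =>
    QMat.mono q p.1 p.2)

/-- The monomial `x_{i,j}` as an element of `𝒜_q(m|n, r)`. -/
def xMono {F : Type*} [Field F] (q : Fˣ) {m n r : ℕ} (i j : Fin r → Fin (m + n)) :
    QMat.homog q m n r :=
  ⟨QMat.mono q i j, Submodule.subset_span ⟨(i, j), rfl⟩⟩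

/-- `∑_{k < l} g k l` over pairs of places. -/
def pairSum {r : ℕ} (g : Fin r → Fin r → ℕ) : ℕ := ∑ k, ∑ l ∈ Finset.Ioi k, g k l

/-- The comodule structure
`δ(v_i) = ∑_j (-1)^{∑_{k<l} ĵ_k (ĵ_l + î_l)} x_{i,j} ⊗ v_j`. -/
def coact {F : Type*} [Field F] (q : Fˣ) (m n r : ℕ) :
    TensorSpace F m n r →ₗ[F] QMat.homog q m n r ⊗[F] TensorSpace F m n r :=
  (vBasis F m n r).constr F fun i => ∑ j : Fin r → Fin (m + n),
    (-1 : F) ^ pairSum (fun k l => parity (j k) * (parity (j l) + parity (i l))) •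
      (xMono q i j ⊗ₜ[F] vBasis F m n r j)

/-- The action `v · f = (f ⊗ id) (δ v)` of the dual of `𝒜_q(m|n, r)` on the tensor superspace. -/
def dualAct {F : Type*} [Field F] (q : Fˣ) (m n r : ℕ) :
    Module.Dual F (QMat.homog q m n r) →ₗ[F] Module.End F (TensorSpace F m n r) where
  toFun f := TensorProduct.lid F (TensorSpace F m n r) ∘ₗ
    LinearMap.rTensor (TensorSpace F m n r) f ∘ₗ coact q m n r
  map_add' f g := by
    rw [LinearMap.rTensor_add, LinearMap.add_comp, LinearMap.comp_add]
  map_smul' c f := by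
    rw [LinearMap.rTensor_smul, LinearMap.smul_comp, LinearMap.comp_smul]
    rfl

/-- The coalgebra structures on `𝒜_q(m|n, r)` given by `Δ(x_{ij}) = ∑_k x_{ik} ⊗ x_{kj}` and
`ε(x_{ij}) = δ_{ij}`, extended multiplicatively to monomials, where the product of tensors is
`(a ⊗ b)(c ⊗ d) = (-1)^{b̂ ĉ} ac ⊗ bd` and `x_{ij}` has parity `î + ĵ`. -/
def IsMatCoalgebra {F : Type*} [Field F] (q : Fˣ) (m n r : ℕ)
    (C : Coalgebra F (QMat.homog q m n r)) : Prop :=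
  (∀ i j : Fin r → Fin (m + n), C.comul (xMono q i j) =
    ∑ p : Fin r → Fin (m + n),
      (-1 : F) ^ pairSum (fun k l =>
          (parity (p k) + parity (j k)) * (parity (i l) + parity (p l))) •
        (xMono q i p ⊗ₜ[F] xMono q p j)) ∧
  ∀ i j : Fin r → Fin (m + n), C.counit (xMono q i j) = if i = j then 1 else 0

end QSuper

end

open QSuper

/-! An operator commutes with the Hecke action exactly when, at each pair of adjacent places, its
matrix satisfies a linear relation between the entries at `(i, j)`, `(i s_k, j)` and `(i, j s_k)`
(`IsCommuting`). Twisted by the sign `sg` of the coaction, these relations are the defining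
quadratic relations of the quantum matrix superalgebra applied to two adjacent factors of a monomial
(`QuadRel.commRel`, `CommRel.quadRel`). Hence functionals in degree `r` and commuting matrices are
the same thing, which gives the bijection onto the `q`-Schur superalgebra (`coef_dualAct`,
`dualAct_injective`, `range_dualAct`). All that is needed from `q` is `q + q⁻¹ ≠ 0`: a repeated pair
of letters of opposite parity yields the eigenvalue equation `q x = -q⁻¹ x`, and this must force `x
= 0`.

For the basis, the triples `(λ, μ, d)` parametrize the pairs `(i_μ, i_λ d)` of words that are sorted
lexicographically and repeat no pair of letters of opposite parity (`Triple.isStandard`,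
`IsStandard.exists_triple`). Straightening shows that a commuting matrix vanishing at these standard
pairs is zero (`IsCommuting.eq_zero`). Conversely, the relative norm of a standard matrix unit
commutes with the Hecke algebra, and its only nonzero entry at a standard pair is a `1` at its own
pair (`relNorm_mem_schurSuper`, `coef_relNorm`). So the norms are, up to `sg`, dual to the standard
monomials; this proves the basis statement and (b) together.

The coalgebra structure is transported from composition of operators: a product of two functionals
is represented by a composite endomorphism, which is again in the range. The comultiplication is
therefore well defined without checking it on relations, and its axioms reduce to the sign
identities `sg_mul_sg` and `comulSign_mul_comulSign`. -/

noncomputable section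

namespace QSuper

/-! ### Symmetric group: inversions, reduced words, shortest coset representatives. -/

section Perm
variable {r : ℕ}

/-- The left place moved by `s_k`. -/
def lo (k : Fin (r - 1)) : Fin r := ⟨k.1, by omega⟩

/-- The right place moved by `s_k`. -/
def hi (k : Fin (r - 1)) : Fin r := ⟨k.1 + 1, by omega⟩

theorem simpleRefl_eq (k : Fin (r - 1)) : simpleRefl k = Equiv.swap (lo k) (hi k) := rfl

theorem lo_lt_hi (k : Fin (r - 1)) : lo k < hi k := by simp [lo, hi]

theorem lo_ne_hi (k : Fin (r - 1)) : lo k ≠ hi k := (lo_lt_hi k).ne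

@[simp] theorem simpleRefl_lo (k : Fin (r - 1)) : simpleRefl k (lo k) = hi k := by
  simp [simpleRefl_eq]

@[simp] theorem simpleRefl_hi (k : Fin (r - 1)) : simpleRefl k (hi k) = lo k := by
  simp [simpleRefl_eq]

theorem simpleRefl_of_ne {k : Fin (r - 1)} {x : Fin r} (h1 : x ≠ lo k) (h2 : x ≠ hi k) :
    simpleRefl k x = x := by
  rw [simpleRefl_eq, Equiv.swap_apply_of_ne_of_ne h1 h2]

@[simp] theorem simpleRefl_mul_self (k : Fin (r - 1)) : simpleRefl k * simpleRefl k = 1 := by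
  simp [simpleRefl_eq]

@[simp] theorem simpleRefl_inv (k : Fin (r - 1)) : (simpleRefl k)⁻¹ = simpleRefl k := by
  simp [simpleRefl_eq]

@[simp] theorem simpleRefl_simpleRefl (k : Fin (r - 1)) (x : Fin r) :
    simpleRefl k (simpleRefl k x) = x := by
  simp [simpleRefl_eq]

@[simp] theorem mul_simpleRefl_mul_simpleRefl (w : Equiv.Perm (Fin r)) (k : Fin (r - 1)) :
    w * simpleRefl k * simpleRefl k = w := by
  rw [mul_assoc, simpleRefl_mul_self, mul_one]

@[simp] theorem simpleRefl_mul_simpleRefl_mul (w : Equiv.Perm (Fin r)) (k : Fin (r - 1)) :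
    simpleRefl k * (simpleRefl k * w) = w := by
  rw [← mul_assoc, simpleRefl_mul_self, one_mul]

/-- A basic transposition preserves the order of every pair of places other than its own. -/
theorem simpleRefl_lt {k : Fin (r - 1)} {a b : Fin r} (h : a < b)
    (hne : ¬ (a = lo k ∧ b = hi k)) : simpleRefl k a < simpleRefl k b := by
  rw [simpleRefl_eq]
  simp only [Equiv.swap_apply_def]
  simp only [lo, hi, Fin.ext_iff, Fin.lt_def] at *
  split_ifs <;> simp_all <;> omega

theorem exists_adjacent_of_not_monotone {α : Type*} [LinearOrder α] {c : Fin r → α}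
    (h : ¬ Monotone c) : ∃ k : Fin (r - 1), c (hi k) < c (lo k) := by
  by_contra! hc
  apply h
  obtain _ | r := r
  · exact fun a => a.elim0
  · rw [Fin.monotone_iff_le_succ]
    intro i
    exact hc i

/-- The inversions of a word. -/
def inversions {α : Type*} [LinearOrder α] (c : Fin r → α) : Finset (Fin r × Fin r) :=
  Finset.univ.filter fun p => p.1 < p.2 ∧ c p.2 < c p.1

theorem mem_inversions {α : Type*} [LinearOrder α] {c : Fin r → α} {p : Fin r × Fin r} :
    p ∈ inversions c ↔ p.1 < p.2 ∧ c p.2 < c p.1 := by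
  simp [inversions]

/-- Moving both places by `s_k` matches the old inversions with the new ones, except for the pair
`(lo k, hi k)` itself, the only pair whose order `s_k` reverses. -/
theorem card_inversions_comp {α : Type*} [LinearOrder α] {c : Fin r → α} {k : Fin (r - 1)}
    (h : c (lo k) < c (hi k)) :
    (inversions (c ∘ simpleRefl k)).card = (inversions c).card + 1 := by
  have e : inversions (c ∘ simpleRefl k) = insert (lo k, hi k)
      ((inversions c).map
        ((simpleRefl k).prodCongr (simpleRefl k)).toEmbedding) := by
    ext ⟨a, b⟩
    simp only [mem_inversions, Finset.mem_insert, Finset.mem_map_equiv, Prod.mk.injEq]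
    simp only [Function.comp_apply, Equiv.prodCongr_symm, Equiv.prodCongr_apply, Prod.map_apply,
      show (simpleRefl k).symm = simpleRefl k from simpleRefl_inv k]
    constructor
    · rintro ⟨h1, h2⟩
      by_cases hab : a = lo k ∧ b = hi k
      · exact Or.inl hab
      · exact Or.inr ⟨simpleRefl_lt h1 hab, h2⟩
    · rintro (⟨rfl, rfl⟩ | ⟨h1, h2⟩)
      · exact ⟨lo_lt_hi k, by simpa using h⟩
      · refine ⟨?_, h2⟩
        have := simpleRefl_lt (k := k) h1 (by
          rintro ⟨h3, h4⟩
          rw [h3, h4] at h2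
          exact absurd h2 h.not_gt)
        simpa using this
  rw [e, Finset.card_insert_of_notMem, Finset.card_map]
  simp only [mem_inversions, Finset.mem_map_equiv]
  simp [(lo_lt_hi k).not_gt, show (simpleRefl k).symm = simpleRefl k from simpleRefl_inv k]

theorem card_inversions_comp_of_gt {α : Type*} [LinearOrder α] {c : Fin r → α} {k : Fin (r - 1)}
    (h : c (hi k) < c (lo k)) :
    (inversions (c ∘ simpleRefl k)).card + 1 = (inversions c).card := by
  have := card_inversions_comp (c := c ∘ simpleRefl k) (k := k) (by simpa using h)
  rw [← this]
  congr 2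
  funext x
  simp

theorem wordProd_cons (k : Fin (r - 1)) (L : List (Fin (r - 1))) :
    wordProd (k :: L) = simpleRefl k * wordProd L := by simp [wordProd]

theorem wordProd_append (L M : List (Fin (r - 1))) :
    wordProd (L ++ M) = wordProd L * wordProd M := by simp [wordProd]

theorem wordProd_reverse (L : List (Fin (r - 1))) :
    wordProd L.reverse = (wordProd L)⁻¹ := by
  induction L with
  | nil => simp [wordProd]
  | cons k L ih =>
    rw [List.reverse_cons, wordProd_append, ih, wordProd_cons k L, mul_inv_rev, simpleRefl_inv]
    simp [wordProd]

theorem len_le (L : List (Fin (r - 1))) : len (wordProd L) ≤ L.length :=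
  Nat.sInf_le ⟨L, rfl, rfl⟩

theorem len_inv (w : Equiv.Perm (Fin r)) : len w⁻¹ = len w := by
  have h : ∀ w : Equiv.Perm (Fin r), len w⁻¹ ≤ len w := by
    intro w
    obtain ⟨L, rfl, hL⟩ := exists_reducedWord w
    rw [← hL, ← wordProd_reverse, ← List.length_reverse]
    exact len_le _
  exact le_antisymm (h w) (by simpa using h w⁻¹)

theorem card_inversions_wordProd_le (L : List (Fin (r - 1))) :
    (inversions (wordProd L)).card ≤ L.length := by
  induction L using List.reverseRecOn with
  | nil =>
    simp only [wordProd, List.map_nil, List.prod_nil, List.length_nil, Nat.le_zero,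
      Finset.card_eq_zero]
    ext p
    simp only [mem_inversions, Equiv.Perm.coe_one, id_eq, Finset.notMem_empty, iff_false]
    exact fun h => absurd h.1 h.2.not_gt
  | append_singleton L k ih =>
    have e : (wordProd (L ++ [k]) : Fin r → Fin r) = wordProd L ∘ simpleRefl k := by
      rw [wordProd_append]; simp [wordProd]
    rw [e, List.length_append, List.length_singleton]
    rcases lt_or_gt_of_ne ((wordProd L).injective.ne (lo_ne_hi k)) with h | h
    · rw [card_inversions_comp h]; omega
    · have := card_inversions_comp_of_gt h; omega

/-- Each letter of a word changes the number of inversions by one, so no word is shorter than that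
number. Conversely, removing adjacent descents one at a time reaches the identity in exactly that
many steps. Length thus becomes something that can be tested at adjacent places. -/
theorem len_eq_card_inversions (w : Equiv.Perm (Fin r)) : len w = (inversions w).card := by
  apply le_antisymm
  · induction hn : (inversions w).card generalizing w with
    | zero =>
      have hw : Monotone w := by
        by_contra h
        obtain ⟨k, hk⟩ := exists_adjacent_of_not_monotone h
        have : (lo k, hi k) ∈ inversions w := mem_inversions.2 ⟨lo_lt_hi k, hk⟩
        rw [Finset.card_eq_zero] at hn
        simp [hn] at this
      have : w = 1 := by
        have := Tuple.unique_monotone (f := id) (σ := w) (τ := 1) hw monotone_id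
        exact DFunLike.coe_injective this
      subst this
      exact len_le []
    | succ t ih =>
      have : ¬ Monotone w := by
        intro h
        obtain ⟨p, hp⟩ := Finset.card_pos.1 (by omega : 0 < (inversions w).card)
        rw [mem_inversions] at hp
        exact absurd (h hp.1.le) hp.2.not_ge
      obtain ⟨k, hk⟩ := exists_adjacent_of_not_monotone this
      have h1 := card_inversions_comp_of_gt hk
      have h2 := ih (w * simpleRefl k) (by rw [Equiv.Perm.coe_mul]; omega)
      obtain ⟨L, hL, hl⟩ := exists_reducedWord (w * simpleRefl k)
      have h3 := len_le (L ++ [k])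
      rw [wordProd_append, hL] at h3
      simp only [wordProd, List.map_singleton, List.prod_singleton,
        mul_simpleRefl_mul_simpleRefl, List.length_append, List.length_singleton] at h3
      omega
  · obtain ⟨L, rfl, hL⟩ := exists_reducedWord w
    rw [← hL]
    exact card_inversions_wordProd_le L

theorem len_one : len (1 : Equiv.Perm (Fin r)) = 0 := by
  simpa [wordProd] using len_le (r := r) []

theorem eq_one_of_len_eq_zero {w : Equiv.Perm (Fin r)} (h : len w = 0) : w = 1 := by
  obtain ⟨L, rfl, hL⟩ := exists_reducedWord w
  rw [h, List.length_eq_zero_iff] at hL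
  simp [hL, wordProd]

theorem len_mul_simpleRefl {w : Equiv.Perm (Fin r)} {k : Fin (r - 1)} (h : w (lo k) < w (hi k)) :
    len (w * simpleRefl k) = len w + 1 := by
  rw [len_eq_card_inversions, len_eq_card_inversions, Equiv.Perm.coe_mul, card_inversions_comp h]

theorem len_mul_simpleRefl_of_gt {w : Equiv.Perm (Fin r)} {k : Fin (r - 1)}
    (h : w (hi k) < w (lo k)) : len (w * simpleRefl k) + 1 = len w := by
  rw [len_eq_card_inversions, len_eq_card_inversions, Equiv.Perm.coe_mul,
    card_inversions_comp_of_gt h]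

theorem len_simpleRefl_mul {w : Equiv.Perm (Fin r)} {k : Fin (r - 1)}
    (h : w⁻¹ (lo k) < w⁻¹ (hi k)) : len (simpleRefl k * w) = len w + 1 := by
  rw [← len_inv, mul_inv_rev, simpleRefl_inv, len_mul_simpleRefl h, len_inv]

theorem len_simpleRefl_mul_of_gt {w : Equiv.Perm (Fin r)} {k : Fin (r - 1)}
    (h : w⁻¹ (hi k) < w⁻¹ (lo k)) : len (simpleRefl k * w) + 1 = len w := by
  rw [← len_inv, mul_inv_rev, simpleRefl_inv, len_mul_simpleRefl_of_gt h, len_inv]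

theorem simpleRefl_mul_descent {w : Equiv.Perm (Fin r)} {k : Fin (r - 1)}
    (h : len (simpleRefl k * w) < len w) : w⁻¹ (hi k) < w⁻¹ (lo k) := by
  by_contra hc
  have : w⁻¹ (lo k) < w⁻¹ (hi k) :=
    lt_of_le_of_ne (not_lt.1 hc) ((w⁻¹).injective.ne (lo_ne_hi k))
  have := len_simpleRefl_mul this
  omega

theorem simpleRefl_far {k j : Fin (r - 1)} (h : k.1 + 1 < j.1) :
    simpleRefl k * simpleRefl j = simpleRefl j * simpleRefl k := by
  ext x
  simp only [Equiv.Perm.coe_mul, Function.comp, simpleRefl, Equiv.swap_apply_def, Fin.ext_iff]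
  grind

theorem simpleRefl_braid {k j : Fin (r - 1)} (h : k.1 + 1 = j.1) :
    simpleRefl k * simpleRefl j * simpleRefl k = simpleRefl j * simpleRefl k * simpleRefl j := by
  ext x
  simp only [Equiv.Perm.coe_mul, Function.comp, simpleRefl, Equiv.swap_apply_def, Fin.ext_iff]
  grind

/-- Matsumoto's theorem for the symmetric group: the product of a family satisfying the braid
relations along a reduced word depends only on the permutation. -/
theorem prod_eq_of_reduced {M : Type*} [Monoid M] (g : Fin (r - 1) → M)
    (braid : ∀ k j : Fin (r - 1), k.1 + 1 = j.1 → g k * g j * g k = g j * g k * g j)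
    (far : ∀ k j : Fin (r - 1), k.1 + 1 < j.1 → g k * g j = g j * g k)
    (L L' : List (Fin (r - 1))) (hL : L.length = len (wordProd L))
    (hL' : L'.length = len (wordProd L')) (h : wordProd L = wordProd L') :
    (L.map g).prod = (L'.map g).prod := by
  induction hN : L.length generalizing L L' with
  | zero =>
    have h1 : L'.length = 0 := by rw [hL', ← h, ← hL, hN]
    rw [List.length_eq_zero_iff] at hN h1
    rw [hN, h1]
  | succ N ih =>
    obtain _ | ⟨s, L1⟩ := L
    · simp at hN
    obtain _ | ⟨t, L2⟩ := L'
    · rw [hL, h, ← hL'] at hN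
      simp at hN
    -- it suffices to join the two words through a third one
    have key : ∀ (u : Fin (r - 1)) (K K' : List (Fin (r - 1))),
        (u :: K).length = len (wordProd (u :: K)) → (u :: K).length = N + 1 →
        (u :: K').length = N + 1 → wordProd (u :: K) = wordProd (u :: K') →
        ((u :: K).map g).prod = ((u :: K').map g).prod := by
      intro u K K' h1 h2 h3 h4
      have h5 : wordProd K = wordProd K' := by
        simpa [wordProd_cons] using h4
      have h6 : K.length ≤ len (wordProd K) := by
        obtain ⟨M, hM, hMl⟩ := exists_reducedWord (wordProd K)
        have := len_le (u :: M)
        rw [wordProd_cons, hM, ← wordProd_cons, ← h1] at this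
        simp at this
        omega
      have h7 := len_le K
      have h8 : K.length = len (wordProd K) := le_antisymm h6 h7
      simp only [List.map_cons, List.prod_cons]
      rw [ih K K' h8 ?_ h5 (by simpa using h2)]
      rw [← h5, ← h8]
      simp at h2 h3
      omega
    have hlw : len (wordProd (s :: L1)) = N + 1 := by rw [← hL, hN]
    have hN' : (t :: L2).length = N + 1 := by rw [hL', ← h, hlw]
    have ds : (wordProd (s :: L1))⁻¹ (hi s) < (wordProd (s :: L1))⁻¹ (lo s) := by
      apply simpleRefl_mul_descent
      rw [hlw, wordProd_cons, simpleRefl_mul_simpleRefl_mul]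
      have := len_le L1
      simp at hN
      omega
    have dt : (wordProd (s :: L1))⁻¹ (hi t) < (wordProd (s :: L1))⁻¹ (lo t) := by
      apply simpleRefl_mul_descent
      rw [hlw, h, wordProd_cons, simpleRefl_mul_simpleRefl_mul]
      have := len_le L2
      simp at hN'
      omega
    -- Both `s` and `t` are left descents and commute, so `w = s t K = t s K` with `K` reduced;
    -- these two words share their first letter with the given ones.
    have hfar : ∀ (s t : Fin (r - 1)) (L1 L2 : List (Fin (r - 1))), s.1 + 1 < t.1 →
        (s :: L1).length = N + 1 → (t :: L2).length = N + 1 →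
        wordProd (s :: L1) = wordProd (t :: L2) → len (wordProd (s :: L1)) = N + 1 →
        (wordProd (s :: L1))⁻¹ (hi s) < (wordProd (s :: L1))⁻¹ (lo s) →
        (wordProd (s :: L1))⁻¹ (hi t) < (wordProd (s :: L1))⁻¹ (lo t) →
        ((s :: L1).map g).prod = ((t :: L2).map g).prod := by
      intro s t L1 L2 hst n1 n2 e hl ds dt
      set w := wordProd (s :: L1) with hw
      obtain ⟨K, hK, hKl⟩ := exists_reducedWord (simpleRefl t * (simpleRefl s * w))
      have l1 := len_simpleRefl_mul_of_gt ds
      have l2 : len (simpleRefl t * (simpleRefl s * w)) + 1 = len (simpleRefl s * w) := by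
        apply len_simpleRefl_mul_of_gt
        rw [mul_inv_rev, simpleRefl_inv, Equiv.Perm.mul_apply, Equiv.Perm.mul_apply,
          simpleRefl_of_ne, simpleRefl_of_ne]
        · exact dt
        all_goals simp [lo, hi, Fin.ext_iff]; omega
      have e1 : wordProd (s :: t :: K) = w := by simp [wordProd_cons, hK]
      have e2 : wordProd (t :: s :: K) = w := by
        rw [wordProd_cons, wordProd_cons, ← mul_assoc, ← simpleRefl_far hst, mul_assoc,
          ← wordProd_cons, ← wordProd_cons, e1]
      rw [key s L1 (t :: K) (by rw [n1, ← hw, hl]) n1 (by simp; omega) (by rw [e1]),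
        ← key t (s :: K) L2 (by rw [e2, hl]; simp; omega) (by simp; omega) n2 (by rw [e2, e])]
      simp only [List.map_cons, List.prod_cons]
      rw [← mul_assoc, far s t hst, mul_assoc]
    -- The two descents make `w⁻¹` decreasing on three consecutive places, so `s t s` can be peeled
    -- off with a drop in length each time: `w = s t s K = t s t K`.
    have hbraid : ∀ (s t : Fin (r - 1)) (L1 L2 : List (Fin (r - 1))), s.1 + 1 = t.1 →
        (s :: L1).length = N + 1 → (t :: L2).length = N + 1 →
        wordProd (s :: L1) = wordProd (t :: L2) → len (wordProd (s :: L1)) = N + 1 →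
        (wordProd (s :: L1))⁻¹ (hi s) < (wordProd (s :: L1))⁻¹ (lo s) →
        (wordProd (s :: L1))⁻¹ (hi t) < (wordProd (s :: L1))⁻¹ (lo t) →
        ((s :: L1).map g).prod = ((t :: L2).map g).prod := by
      intro s t L1 L2 hst n1 n2 e hl ds dt
      set w := wordProd (s :: L1) with hw
      have hts : lo t = hi s := by simp [lo, hi, hst]
      have s3 : simpleRefl s (hi t) = hi t := by
        apply simpleRefl_of_ne <;> simp [lo, hi, Fin.ext_iff] <;> omega
      have t1 : simpleRefl t (lo s) = lo s := by
        apply simpleRefl_of_ne <;> simp [lo, hi, Fin.ext_iff] <;> omega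
      obtain ⟨K, hK, hKl⟩ :=
        exists_reducedWord (simpleRefl s * (simpleRefl t * (simpleRefl s * w)))
      have l1 := len_simpleRefl_mul_of_gt ds
      have l2 : len (simpleRefl t * (simpleRefl s * w)) + 1 = len (simpleRefl s * w) := by
        apply len_simpleRefl_mul_of_gt
        rw [mul_inv_rev, simpleRefl_inv, Equiv.Perm.mul_apply, Equiv.Perm.mul_apply, s3, hts,
          simpleRefl_hi]
        rw [hts] at dt
        exact dt.trans ds
      have l3 : len (simpleRefl s * (simpleRefl t * (simpleRefl s * w))) + 1
          = len (simpleRefl t * (simpleRefl s * w)) := by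
        apply len_simpleRefl_mul_of_gt
        rw [mul_inv_rev, mul_inv_rev, simpleRefl_inv, simpleRefl_inv]
        simp only [Equiv.Perm.mul_apply]
        rw [t1, ← hts, simpleRefl_lo, s3, simpleRefl_lo, ← hts]
        exact dt
      have e1 : wordProd (s :: t :: s :: K) = w := by simp [wordProd_cons, hK]
      have e2 : wordProd (t :: s :: t :: K) = w := by
        rw [← e1]
        simp only [wordProd_cons, ← mul_assoc]
        rw [simpleRefl_braid hst]
      rw [key s L1 (t :: s :: K) (by rw [n1, ← hw, hl]) n1 (by simp; omega) (by rw [e1]),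
        ← key t (s :: t :: K) L2 (by rw [e2, hl]; simp; omega) (by simp; omega) n2
          (by rw [e2, e])]
      simp only [List.map_cons, List.prod_cons, ← mul_assoc]
      rw [braid s t hst]
    rcases lt_trichotomy s.1 t.1 with hst | hst | hst
    · rcases Nat.lt_or_eq_of_le (Nat.succ_le_of_lt hst) with h1 | h1
      · exact hfar s t L1 L2 h1 hN hN' h hlw ds dt
      · exact hbraid s t L1 L2 h1 hN hN' h hlw ds dt
    · obtain rfl := Fin.ext hst
      exact key s L1 L2 hL hN hN' h
    · rw [h] at ds dt hlw
      rcases Nat.lt_or_eq_of_le (Nat.succ_le_of_lt hst) with h1 | h1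
      · exact (hfar t s L2 L1 h1 hN' hN h.symm hlw dt ds).symm
      · exact (hbraid t s L2 L1 h1 hN' hN h.symm hlw dt ds).symm

/-- The stabilizer of a word. -/
def wordStab {α : Type*} (c : Fin r → α) : Subgroup (Equiv.Perm (Fin r)) where
  carrier := {w | ∀ k, c (w k) = c k}
  mul_mem' {a b} ha hb k := (ha (b k)).trans (hb k)
  one_mem' k := rfl
  inv_mem' {a} ha k := by
    have h1 := ha (a⁻¹ k)
    simpa using h1.symm

theorem mem_wordStab {α : Type*} {c : Fin r → α} {w : Equiv.Perm (Fin r)} :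
    w ∈ wordStab c ↔ ∀ k, c (w k) = c k := Iff.rfl

theorem simpleRefl_mem_wordStab {α : Type*} {c : Fin r → α} {k : Fin (r - 1)}
    (h : c (lo k) = c (hi k)) : simpleRefl k ∈ wordStab c := by
  intro x
  by_cases h1 : x = lo k
  · simp [h1, h]
  by_cases h2 : x = hi k
  · simp [h2, h]
  rw [simpleRefl_of_ne h1 h2]

/-- The shortest representatives of the right cosets of the stabilizer of a weakly increasing
word are the permutations whose inverse is increasing on its level sets. -/
theorem mem_distinguished_iff {α : Type*} [LinearOrder α] {c : Fin r → α} (hc : Monotone c)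
    {w : Equiv.Perm (Fin r)} :
    w ∈ distinguished (wordStab c) ↔ ∀ a b, a < b → c a = c b → w⁻¹ a < w⁻¹ b := by
  constructor
  · intro hw
    have adj : ∀ k : Fin (r - 1), c (lo k) = c (hi k) → w⁻¹ (lo k) < w⁻¹ (hi k) := by
      intro k hk
      by_contra hcon
      have h1 : w⁻¹ (hi k) < w⁻¹ (lo k) :=
        lt_of_le_of_ne (not_lt.1 hcon) ((w⁻¹).injective.ne (lo_ne_hi k).symm)
      have h2 := len_simpleRefl_mul_of_gt h1
      have h3 := hw _ (simpleRefl_mem_wordStab hk)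
      omega
    -- The level sets of a monotone word are intervals, so adjacent comparisons chain together.
    have main : ∀ (n : ℕ) (a b : Fin r), a.1 + n + 1 = b.1 → c a = c b → w⁻¹ a < w⁻¹ b := by
      intro n
      induction n with
      | zero =>
        intro a b hab h
        have hk : a.1 < r - 1 := by omega
        have ha : a = lo ⟨a.1, hk⟩ := rfl
        have hb : b = hi ⟨a.1, hk⟩ := Fin.ext (by simp [hi]; omega)
        rw [ha, hb] at h ⊢
        exact adj _ h
      | succ n ih =>
        intro a b hab h
        have hk : b.1 - 1 < r - 1 := by omega
        have hb : b = hi ⟨b.1 - 1, hk⟩ := Fin.ext (by simp [hi]; omega)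
        set m : Fin r := lo ⟨b.1 - 1, hk⟩ with hm
        have hmv : m.1 = b.1 - 1 := rfl
        have hcm : c a = c m := le_antisymm (hc (by rw [Fin.le_def]; omega))
          (h ▸ hc (by rw [Fin.le_def]; omega))
        refine (ih a m (by omega) hcm).trans ?_
        have := adj ⟨b.1 - 1, hk⟩ (by rw [← hm, ← hb, ← h, hcm])
        rwa [← hb] at this
    intro a b hab h
    exact main (b.1 - a.1 - 1) a b (by rw [Fin.lt_def] at hab; omega) h
  · intro h u hu
    rw [← len_inv w, ← len_inv (u * w), mul_inv_rev, len_eq_card_inversions,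
      len_eq_card_inversions]
    -- An inversion of `w⁻¹` joins two different level sets; `u` preserves each of them and hence
    -- their order, so it carries the pair to an inversion of `w⁻¹ u⁻¹`.
    refine Finset.card_le_card_of_injOn (fun p => (u p.1, u p.2)) ?_ ?_
    · rintro ⟨a, b⟩ hp
      rw [Finset.mem_coe, mem_inversions] at hp ⊢
      obtain ⟨h1, h2⟩ := hp
      simp only at h1 h2
      have hne : c a ≠ c b := fun h3 => absurd (h a b h1 h3) h2.not_gt
      have hlt : c a < c b := lt_of_le_of_ne (hc h1.le) hne
      refine ⟨?_, by simpa using h2⟩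
      by_contra h4
      have := hc (not_lt.1 h4)
      simp only [mem_wordStab.1 hu] at this
      exact absurd hlt this.not_gt
    · rintro ⟨a, b⟩ - ⟨a', b'⟩ - h1
      simpa using h1

theorem eq_one_of_mem_distinguished {W' : Subgroup (Equiv.Perm (Fin r))}
    {w : Equiv.Perm (Fin r)} (h : w ∈ distinguished W') (hw : w ∈ W') : w = 1 := by
  apply eq_one_of_len_eq_zero
  have := h w⁻¹ (inv_mem hw)
  rw [inv_mul_cancel, len_one] at this
  omega

/-- Right multiplication by `s_k` reverses only the pair `w (lo k), w (hi k)`, and by assumption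
these places lie in different level sets. -/
theorem mul_simpleRefl_mem_distinguished {α : Type*} [LinearOrder α] {c : Fin r → α}
    (hc : Monotone c) {w : Equiv.Perm (Fin r)} (hw : w ∈ distinguished (wordStab c))
    {k : Fin (r - 1)} (h : c (w (lo k)) ≠ c (w (hi k))) :
    w * simpleRefl k ∈ distinguished (wordStab c) := by
  rw [mem_distinguished_iff hc] at hw ⊢
  intro a b hab he
  rw [mul_inv_rev, simpleRefl_inv, Equiv.Perm.mul_apply, Equiv.Perm.mul_apply]
  refine simpleRefl_lt (hw a b hab he) ?_
  rintro ⟨h1, h2⟩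
  apply h
  rw [← h1, ← h2]
  simpa using he

/-- If `w` is a shortest coset representative and `w s` is not, then `w s = t w` for a basic
transposition `t` of the stabilizer. -/
theorem exists_simpleRefl_mul_eq {α : Type*} [LinearOrder α] {c : Fin r → α}
    (hc : Monotone c) {w : Equiv.Perm (Fin r)} (hw : w ∈ distinguished (wordStab c))
    {k : Fin (r - 1)} (h : c (w (lo k)) = c (w (hi k))) :
    ∃ t : Fin (r - 1), w (lo k) = lo t ∧ w (hi k) = hi t := by
  rw [mem_distinguished_iff hc] at hw
  have hinv : ∀ x, w⁻¹ (w x) = x := w.symm_apply_apply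
  have hlt : w (lo k) < w (hi k) := by
    by_contra hcon
    have h1 : w (hi k) < w (lo k) :=
      lt_of_le_of_ne (not_lt.1 hcon) (w.injective.ne (lo_ne_hi k).symm)
    have := hw _ _ h1 h.symm
    simp only [hinv] at this
    exact absurd this (lo_lt_hi k).not_gt
  have hlt' : (w (lo k)).1 < (w (hi k)).1 := hlt
  have hk : (w (lo k)).1 < r - 1 := by omega
  refine ⟨⟨_, hk⟩, rfl, ?_⟩
  -- A place `m` strictly between the two images would lie in the same level set, and `w⁻¹ m` would
  -- lie strictly between the adjacent places `lo k` and `hi k`.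
  by_contra hne
  set m : Fin r := hi ⟨_, hk⟩ with hm
  have hmv : m.1 = (w (lo k)).1 + 1 := rfl
  have h1 : w (lo k) < m := by rw [Fin.lt_def]; omega
  have h2 : m < w (hi k) := lt_of_le_of_ne (by rw [Fin.le_def]; omega) (Ne.symm hne)
  have hcm : c (w (lo k)) = c m := le_antisymm (hc h1.le) (h ▸ hc h2.le)
  have h3 := hw _ _ h1 hcm
  have h4 := hw _ _ h2 (hcm ▸ h)
  rw [hinv] at h3 h4
  rw [Fin.lt_def] at h3 h4
  simp only [lo, hi] at h3 h4
  omega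

end Perm

/-! ### Operators of the Hecke algebra and relative norms. -/

section HeckeAction
variable {F : Type*} [Field F] (q : Fˣ) {m n r : ℕ}

/-- Matsumoto's theorem removes the dependence on the reduced word chosen in `Hecke.T`. -/
theorem Hecke.T_wordProd (L : List (Fin (r - 1))) (hL : L.length = len (wordProd L)) :
    Hecke.T q (wordProd L) = (L.map (Hecke.gen q)).prod := by
  have hs := (exists_reducedWord (wordProd L)).choose_spec
  refine prod_eq_of_reduced (Hecke.gen q) ?_ ?_ _ L ?_ hL hs.1
  · intro k j h
    simp only [Hecke.gen, ← map_mul]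
    exact RingQuot.mkAlgHom_rel F (HeckeRel.braid k j h)
  · intro k j h
    simp only [Hecke.gen, ← map_mul]
    exact RingQuot.mkAlgHom_rel F (HeckeRel.far k j h)
  · exact hs.2.trans (congrArg len hs.1.symm)

theorem Hecke.T_one : Hecke.T q (1 : Equiv.Perm (Fin r)) = 1 := by
  have := Hecke.T_wordProd q ([] : List (Fin (r - 1))) (by simp [wordProd, len_one])
  simpa [wordProd] using this

theorem Hecke.T_mul_simpleRefl {w : Equiv.Perm (Fin r)} {k : Fin (r - 1)}
    (h : w (lo k) < w (hi k)) : Hecke.T q (w * simpleRefl k) = Hecke.T q w * Hecke.gen q k := by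
  obtain ⟨L, rfl, hL⟩ := exists_reducedWord w
  have e : wordProd L * simpleRefl k = wordProd (L ++ [k]) := by
    rw [wordProd_append]; simp [wordProd]
  rw [e, Hecke.T_wordProd q (L ++ [k]), Hecke.T_wordProd q L hL]
  · simp
  · rw [← e, len_mul_simpleRefl h, ← hL]
    simp

theorem Hecke.T_simpleRefl_mul {w : Equiv.Perm (Fin r)} {k : Fin (r - 1)}
    (h : w⁻¹ (lo k) < w⁻¹ (hi k)) :
    Hecke.T q (simpleRefl k * w) = Hecke.gen q k * Hecke.T q w := by
  obtain ⟨L, rfl, hL⟩ := exists_reducedWord w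
  rw [← wordProd_cons, Hecke.T_wordProd q (k :: L), Hecke.T_wordProd q L hL]
  · simp
  · rw [wordProd_cons, len_simpleRefl_mul h, ← hL]
    simp

/-- The order is reversed because a right action is written with operators on the left. -/
theorem act_mul {q : Fˣ} (h h' : Hecke q r) : act m n (h * h') = act m n h' * act m n h := by
  simp [act]

theorem act_one {q : Fˣ} : act m n (1 : Hecke q r) = 1 := by
  simp [act]

/-- The operator `v ↦ v 𝒯_w`. -/
def opT (m n : ℕ) (w : Equiv.Perm (Fin r)) : Module.End F (TensorSpace F m n r) :=
  act m n (Hecke.T q w)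

theorem opT_one : opT q m n (1 : Equiv.Perm (Fin r)) = 1 := by
  rw [opT, Hecke.T_one, act_one]

theorem opT_mul_simpleRefl {w : Equiv.Perm (Fin r)} {k : Fin (r - 1)}
    (h : w (lo k) < w (hi k)) : opT q m n (w * simpleRefl k) = genOp q m n k * opT q m n w := by
  rw [opT, Hecke.T_mul_simpleRefl q h, act_mul, act_gen, opT]

theorem opT_simpleRefl_mul {w : Equiv.Perm (Fin r)} {k : Fin (r - 1)}
    (h : w⁻¹ (lo k) < w⁻¹ (hi k)) :
    opT q m n (simpleRefl k * w) = opT q m n w * genOp q m n k := by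
  rw [opT, Hecke.T_simpleRefl_mul q h, act_mul, act_gen, opT]

/-- The `q`-Schur superalgebra consists of the operators commuting with the generators. -/
theorem mem_schurSuper_iff {φ : Module.End F (TensorSpace F m n r)} :
    φ ∈ schurSuper q m n r ↔ ∀ k, genOp q m n k * φ = φ * genOp q m n k := by
  rw [schurSuper, Subalgebra.mem_centralizer_iff]
  constructor
  · intro h k
    exact h _ ⟨Hecke.gen q k, act_gen q m n k⟩
  · rintro h _ ⟨x, rfl⟩
    obtain ⟨y, rfl⟩ := RingQuot.mkAlgHom_surjective F (HeckeRel q r) x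
    induction y using FreeAlgebra.induction with
    | grade0 c => simp [act, Algebra.commutes c φ]
    | grade1 k =>
      have e := act_gen q m n k
      rw [Hecke.gen] at e
      dsimp only
      rw [e, h k]
    | mul a b ha hb =>
      dsimp only at ha hb ⊢
      rw [map_mul, act_mul, mul_assoc, ha, ← mul_assoc, hb, mul_assoc]
    | add a b ha hb =>
      have e : ∀ x y : Hecke q r, act m n (x + y) = act m n x + act m n y := by simp [act]
      dsimp only at ha hb ⊢
      rw [map_add, e, add_mul, mul_add, ha, hb]

theorem relNorm_eq (W' : Subgroup (Equiv.Perm (Fin r)))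
    [DecidablePred fun w => w ∈ distinguished W'] (b : Module.End F (TensorSpace F m n r)) :
    relNorm q W' b = ∑ w ∈ Finset.univ.filter (fun w => w ∈ distinguished W'),
      opT q m n w * b * opT q m n w⁻¹ := by
  rw [relNorm]
  refine Finset.sum_congr ?_ fun w _ => ?_
  · ext w; simp
  · rw [mul_assoc]; rfl

/-- The relative norm of an operator commuting with the Hecke algebra of a parabolic subgroup
commutes with the Hecke algebra. -/
theorem relNorm_mem_schurSuper {α : Type*} [LinearOrder α] {c : Fin r → α} (hc : Monotone c)
    {b : Module.End F (TensorSpace F m n r)}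
    (hb : ∀ t, c (lo t) = c (hi t) → genOp q m n t * b = b * genOp q m n t) :
    relNorm q (wordStab c) b ∈ schurSuper q m n r := by
  classical
  rw [mem_schurSuper_iff]
  intro k
  rw [relNorm_eq, ← sub_eq_zero, Finset.mul_sum, Finset.sum_mul]
  refine (Finset.sum_sub_distrib (G := Module.End F (TensorSpace F m n r)) _ _).symm.trans ?_
  set S := genOp q m n k with hS
  have quad : S * S = ((q : F) - (q : F)⁻¹) • S + 1 := genOp_quadratic q k
  -- If `Y` is the term of `w`, that of `w s_k` is `S Y S`; by the quadratic relation the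
  -- commutators of `S` with `Y` and with `S Y S` cancel.
  have pair : ∀ w : Equiv.Perm (Fin r), w (lo k) < w (hi k) →
      S * (opT q m n w * b * opT q m n w⁻¹) - opT q m n w * b * opT q m n w⁻¹ * S +
      (S * (opT q m n (w * simpleRefl k) * b * opT q m n (w * simpleRefl k)⁻¹)
        - opT q m n (w * simpleRefl k) * b * opT q m n (w * simpleRefl k)⁻¹ * S) = 0 := by
    intro w h
    have hinv : ∀ x, w⁻¹⁻¹ x = w x := by simp
    rw [opT_mul_simpleRefl q h, mul_inv_rev, simpleRefl_inv,
      opT_simpleRefl_mul q (w := w⁻¹) (by rwa [hinv, hinv]), ← hS]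
    set Y := opT q m n w * b * opT q m n w⁻¹ with hY
    have e : S * opT q m n w * b * (opT q m n w⁻¹ * S) = S * Y * S := by
      simp only [hY, mul_assoc]
    have e1 : S * (S * Y * S) = ((q : F) - (q : F)⁻¹) • (S * Y * S) + Y * S := by
      rw [← mul_assoc, ← mul_assoc, quad, add_mul, add_mul, one_mul, smul_mul_assoc,
        smul_mul_assoc]
    have e2 : S * Y * S * S = ((q : F) - (q : F)⁻¹) • (S * Y * S) + S * Y := by
      rw [mul_assoc (S * Y), quad, mul_add, mul_one, mul_smul_comm]
    rw [e, e1, e2]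
    abel
  -- Here `w s_k = t w` with `t` in the stabilizer, so `S` passes through the outer factors as the
  -- generator of `t`, which commutes with `b`.
  have fixed : ∀ w ∈ distinguished (wordStab c), c (w (lo k)) = c (w (hi k)) →
      S * (opT q m n w * b * opT q m n w⁻¹) - opT q m n w * b * opT q m n w⁻¹ * S = 0 := by
    intro w hw' hcw
    obtain ⟨t, h1, h2⟩ := exists_simpleRefl_mul_eq hc hw' hcw
    have hwt : w * simpleRefl k = simpleRefl t * w := by
      rw [simpleRefl_eq t, ← h1, ← h2, simpleRefl_eq]
      ext x
      simp [Equiv.swap_apply_def]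
      grind
    have htw : simpleRefl k * w⁻¹ = w⁻¹ * simpleRefl t := by
      rw [← simpleRefl_inv, ← mul_inv_rev, hwt, mul_inv_rev, simpleRefl_inv]
    have i1 : w⁻¹ (lo t) = lo k := by rw [← h1]; exact w.symm_apply_apply _
    have i2 : w⁻¹ (hi t) = hi k := by rw [← h2]; exact w.symm_apply_apply _
    have hinv : ∀ x, w⁻¹⁻¹ x = w x := by simp
    have c1 : S * opT q m n w = opT q m n w * genOp q m n t := by
      rw [hS, ← opT_mul_simpleRefl, hwt, opT_simpleRefl_mul]
      · rw [i1, i2]; exact lo_lt_hi k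
      · rw [h1, h2]; exact lo_lt_hi t
    have c2 : opT q m n w⁻¹ * S = genOp q m n t * opT q m n w⁻¹ := by
      rw [hS, ← opT_simpleRefl_mul, htw, opT_mul_simpleRefl]
      · rw [i1, i2]; exact lo_lt_hi k
      · rw [hinv, hinv, h1, h2]; exact lo_lt_hi t
    have : S * (opT q m n w * b * opT q m n w⁻¹) = opT q m n w * b * opT q m n w⁻¹ * S := by
      rw [mul_assoc _ _ S, c2, ← mul_assoc, ← mul_assoc, c1, mul_assoc _ _ b,
        hb t (by rw [← h1, ← h2, hcw])]
      simp only [mul_assoc]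
    exact sub_eq_zero.2 this
  -- The representatives are matched by `w ↔ w s_k` when `w s_k` is again one; the others are fixed,
  -- and their commutator is already zero.
  refine Finset.sum_involution
    (fun w _ => if c (w (lo k)) = c (w (hi k)) then w else w * simpleRefl k) ?_ ?_ ?_ ?_
  · intro w hw
    have hw' := (Finset.mem_filter.1 hw).2
    split_ifs with hcw
    · rw [fixed w hw' hcw, add_zero]
    · rcases lt_or_gt_of_ne (w.injective.ne (lo_ne_hi k)) with h | h
      · exact pair w h
      · have := pair (w * simpleRefl k) (by simpa using h)
        rw [mul_simpleRefl_mul_simpleRefl] at this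
        exact (add_comm _ _).trans this
  · intro w hw hne
    have hw' := (Finset.mem_filter.1 hw).2
    split_ifs with hcw
    · exfalso
      exact hne (fixed w hw' hcw)
    · intro h
      have h1 : simpleRefl k = 1 := by simpa using h
      have := simpleRefl_lo k
      rw [h1] at this
      exact lo_ne_hi k this
  · intro w hw
    have hw' := (Finset.mem_filter.1 hw).2
    split_ifs with hcw
    · exact hw
    · exact Finset.mem_filter.2 ⟨Finset.mem_univ _, mul_simpleRefl_mem_distinguished hc hw' hcw⟩
  · intro w hw
    split_ifs with h1 h2
    · rfl
    · simp at h2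
      exact absurd h2.symm h1
    · simp

end HeckeAction

/-! ### Matrix entries of operators and the signs of the coaction. -/

section Coefficients
variable {F : Type*} [Field F] (q : Fˣ) {m n r : ℕ}

theorem parity_eq_zero {a : Fin (m + n)} (h : a.1 < m) : parity a = 0 := if_pos h

theorem parity_eq_one {a : Fin (m + n)} (h : ¬ a.1 < m) : parity a = 1 := if_neg h

theorem offCoef_comm (a b : Fin (m + n)) : offCoef F a b = offCoef F b a := by
  simp [offCoef, eq_comm, mul_comm]

/-- The coefficient of `v_j` in `φ(v_i)`. -/
def coef (φ : Module.End F (TensorSpace F m n r)) (i j : Fin r → Fin (m + n)) : F :=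
  (vBasis F m n r).repr (φ (vBasis F m n r i)) j

theorem coef_ext {φ ψ : Module.End F (TensorSpace F m n r)}
    (h : ∀ i j, coef φ i j = coef ψ i j) : φ = ψ :=
  (vBasis F m n r).ext fun i => (vBasis F m n r).repr.injective (Finsupp.ext (h i))

theorem comp_simpleRefl_comp {α : Type*} (i : Fin r → α) (k : Fin (r - 1)) :
    (i ∘ simpleRefl k) ∘ simpleRefl k = i := by
  funext x; simp

/-- The matrix of a generator is symmetric, since `offCoef` is symmetric and `s_k` is an involution
on words; so the formula for coordinates has the shape of `genOp_basis`. -/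
theorem repr_genOp (k : Fin (r - 1)) (v : TensorSpace F m n r) (j : Fin r → Fin (m + n)) :
    (vBasis F m n r).repr (genOp q m n k v) j =
      offCoef F (j (lo k)) (j (hi k)) * (vBasis F m n r).repr v (j ∘ simpleRefl k) +
      diagCoef q (j (lo k)) (j (hi k)) * (vBasis F m n r).repr v j := by
  have hv := (vBasis F m n r).mem_span v
  induction hv using Submodule.span_induction with
  | zero => simp
  | add x y _ _ hx hy =>
    simp only [map_add, Finsupp.add_apply, hx, hy]; ring
  | smul c x _ hx =>
    simp only [map_smul, Finsupp.smul_apply, hx, smul_eq_mul]; ring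
  | mem x hx =>
    obtain ⟨i, rfl⟩ := hx
    rw [genOp_basis]
    change (vBasis F m n r).repr (offCoef F (i (lo k)) (i (hi k)) • _ +
      diagCoef q (i (lo k)) (i (hi k)) • _) j = _
    simp only [map_add, map_smul, Module.Basis.repr_self, Finsupp.add_apply, Finsupp.smul_apply,
      smul_eq_mul, Finsupp.single_apply]
    have e : i ∘ simpleRefl k = j ↔ i = j ∘ simpleRefl k := by
      constructor
      · rintro rfl; exact (comp_simpleRefl_comp i k).symm
      · rintro rfl; exact comp_simpleRefl_comp j k
    simp only [e]
    congr 1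
    · split_ifs with h
      · subst h
        simp [offCoef_comm]
      · simp
    · split_ifs with h
      · rw [h]
      · simp

/-- The matrices of operators commuting with the action of the Hecke algebra. -/
def IsCommuting (a : (Fin r → Fin (m + n)) → (Fin r → Fin (m + n)) → F) : Prop :=
  ∀ k i j,
    offCoef F (i (lo k)) (i (hi k)) * a (i ∘ simpleRefl k) j +
      diagCoef q (i (lo k)) (i (hi k)) * a i j =
    diagCoef q (j (lo k)) (j (hi k)) * a i j +
      offCoef F (j (lo k)) (j (hi k)) * a i (j ∘ simpleRefl k)

theorem mem_schurSuper_iff_coef {φ : Module.End F (TensorSpace F m n r)} :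
    φ ∈ schurSuper q m n r ↔ IsCommuting q (coef φ) := by
  rw [mem_schurSuper_iff]
  refine forall_congr' fun k => ?_
  have e1 : ∀ i j, coef (genOp q m n k * φ) i j =
      diagCoef q (j (lo k)) (j (hi k)) * coef φ i j +
      offCoef F (j (lo k)) (j (hi k)) * coef φ i (j ∘ simpleRefl k) := by
    intro i j
    rw [coef, Module.End.mul_apply, repr_genOp, add_comm]; rfl
  have e2 : ∀ i j, coef (φ * genOp q m n k) i j =
      offCoef F (i (lo k)) (i (hi k)) * coef φ (i ∘ simpleRefl k) j +
      diagCoef q (i (lo k)) (i (hi k)) * coef φ i j := by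
    intro i j
    rw [coef, Module.End.mul_apply, genOp_basis]
    simp only [map_add, map_smul, Finsupp.add_apply, Finsupp.smul_apply, smul_eq_mul]; rfl
  constructor
  · intro h i j
    rw [← e1, ← e2, h]
  · intro h
    refine coef_ext fun i j => ?_
    rw [e1, e2, h]

/-! ### Signs -/

theorem pairSum_add (g h : Fin r → Fin r → ℕ) :
    pairSum (fun k l => g k l + h k l) = pairSum g + pairSum h := by
  simp [pairSum, Finset.sum_add_distrib]

theorem lt_simpleRefl_iff {k : Fin (r - 1)} {a l : Fin r} (h : a ≠ lo k) :
    a < simpleRefl k l ↔ a < l := by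
  by_cases h1 : l = lo k
  · subst h1
    rw [simpleRefl_lo]
    simp only [lo, hi, Fin.lt_def, ne_eq, Fin.ext_iff] at *
    omega
  by_cases h2 : l = hi k
  · subst h2
    rw [simpleRefl_hi]
    simp only [lo, hi, Fin.lt_def, ne_eq, Fin.ext_iff] at *
    omega
  rw [simpleRefl_of_ne h1 h2]

theorem sum_Ioi_simpleRefl {k : Fin (r - 1)} {a : Fin r} (h : a ≠ lo k) (y : Fin r → ℕ) :
    ∑ l ∈ Finset.Ioi a, y (simpleRefl k l) = ∑ l ∈ Finset.Ioi a, y l :=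
  Finset.sum_equiv (simpleRefl k) (fun l => by simp [lt_simpleRefl_iff h]) fun _ _ => rfl

theorem sum_Ioi_lo (k : Fin (r - 1)) (y : Fin r → ℕ) :
    ∑ l ∈ Finset.Ioi (lo k), y l = y (hi k) + ∑ l ∈ Finset.Ioi (hi k), y l := by
  have : Finset.Ioi (lo k) = insert (hi k) (Finset.Ioi (hi k)) := by
    ext l
    simp only [Finset.mem_Ioi, Finset.mem_insert, lo, hi, Fin.lt_def, Fin.ext_iff]
    omega
  rw [this, Finset.sum_insert (by simp)]

/-- The effect on a bilinear pair sum of exchanging two adjacent right factors. -/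
theorem pairSum_simpleRefl_right (k : Fin (r - 1)) (x y : Fin r → ℕ) :
    pairSum (fun a l => x a * y (simpleRefl k l)) + x (lo k) * y (hi k) =
      pairSum (fun a l => x a * y l) + x (lo k) * y (lo k) := by
  simp only [pairSum, ← Finset.mul_sum]
  rw [← Finset.add_sum_erase _ _ (Finset.mem_univ (lo k)),
    ← Finset.add_sum_erase (Finset.univ) (fun a => x a * ∑ l ∈ Finset.Ioi a, y l)
      (Finset.mem_univ (lo k)), sum_Ioi_lo, sum_Ioi_lo, simpleRefl_hi,
    sum_Ioi_simpleRefl (lo_ne_hi k).symm]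
  have : ∀ a ∈ Finset.univ.erase (lo k), x a * ∑ l ∈ Finset.Ioi a, y (simpleRefl k l) =
      x a * ∑ l ∈ Finset.Ioi a, y l := by
    intro a ha
    rw [sum_Ioi_simpleRefl (Finset.ne_of_mem_erase ha)]
  rw [Finset.sum_congr rfl this]
  ring

/-- Applying `s_k` to both indices permutes the pairs `a < l` other than `(lo k, hi k)`; only that
pair contributes a correction. -/
theorem pairSum_simpleRefl_both (k : Fin (r - 1)) (x y : Fin r → ℕ) :
    pairSum (fun a l => x (simpleRefl k a) * y (simpleRefl k l)) + x (lo k) * y (hi k) =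
      pairSum (fun a l => x a * y l) + x (hi k) * y (lo k) := by
  have h : ∀ g : Fin r → Fin r → ℕ, pairSum g =
      ∑ p ∈ Finset.univ.filter (fun p : Fin r × Fin r => p.1 < p.2), g p.1 p.2 := by
    intro g
    rw [pairSum, Finset.sum_filter, Fintype.sum_prod_type]
    refine Finset.sum_congr rfl fun a _ => ?_
    rw [← Finset.sum_filter]
    congr 1
    ext; simp
  have hm : (lo k, hi k) ∈ Finset.univ.filter (fun p : Fin r × Fin r => p.1 < p.2) := by
    simp [lo_lt_hi]
  rw [h, h, ← Finset.add_sum_erase _ _ hm, ← Finset.add_sum_erase _ (fun p => x p.1 * y p.2) hm]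
  have : ∑ p ∈ (Finset.univ.filter (fun p : Fin r × Fin r => p.1 < p.2)).erase (lo k, hi k),
      x (simpleRefl k p.1) * y (simpleRefl k p.2) =
      ∑ p ∈ (Finset.univ.filter (fun p : Fin r × Fin r => p.1 < p.2)).erase (lo k, hi k),
      x p.1 * y p.2 := by
    have fwd : ∀ p : Fin r × Fin r, p.1 < p.2 → p ≠ (lo k, hi k) →
        simpleRefl k p.1 < simpleRefl k p.2 ∧
          (simpleRefl k p.1, simpleRefl k p.2) ≠ (lo k, hi k) := by
      rintro ⟨a, b⟩ hab hne
      refine ⟨simpleRefl_lt hab fun h => hne (Prod.ext h.1 h.2), ?_⟩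
      intro he
      rw [Prod.mk.injEq] at he
      have h1 : a = hi k := by rw [← simpleRefl_simpleRefl k a, he.1, simpleRefl_lo]
      have h2 : b = lo k := by rw [← simpleRefl_simpleRefl k b, he.2, simpleRefl_hi]
      rw [h1, h2] at hab
      exact absurd hab (lo_lt_hi k).not_gt
    refine Finset.sum_equiv ((simpleRefl k).prodCongr (simpleRefl k)) (fun p => ?_) fun _ _ => rfl
    simp only [Finset.mem_erase, Finset.mem_filter, Finset.mem_univ, true_and,
      Equiv.prodCongr_apply, Prod.map]
    constructor
    · rintro ⟨h1, h2⟩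
      exact (fwd p h2 h1).symm
    · rintro ⟨h1, h2⟩
      have := fwd _ h2 h1
      simp only [simpleRefl_simpleRefl] at this
      exact this.symm
  rw [this]
  simp only [simpleRefl_lo, simpleRefl_hi]
  ring

variable (F) in
/-- The sign occurring in the coaction. -/
def sg (i j : Fin r → Fin (m + n)) : F :=
  (-1) ^ pairSum (fun k l => parity (j k) * (parity (j l) + parity (i l)))

theorem sg_mul_self (i j : Fin r → Fin (m + n)) : sg F i j * sg F i j = 1 := by
  rw [sg, ← pow_add, ← two_mul, pow_mul]; simp

/-- Sign identities thereby become polynomial identities over `ZMod 2`. -/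
theorem neg_one_pow_eq_of_cast_eq {x y : ℕ} (h : (x : ZMod 2) = y) : (-1 : F) ^ x = (-1) ^ y := by
  rw [ZMod.natCast_eq_natCast_iff] at h
  rw [neg_one_pow_eq_pow_mod_two, h, ← neg_one_pow_eq_pow_mod_two]

/-- The correction factors here and in `sg_simpleRefl_right` are exactly the extra signs in
`CommRel`: they are what separates commuting matrices from the superalgebra relations. -/
theorem sg_simpleRefl_left (k : Fin (r - 1)) (i j : Fin r → Fin (m + n)) :
    sg F (i ∘ simpleRefl k) j =
      sg F i j * (-1) ^ (parity (j (lo k)) * (parity (i (lo k)) + parity (i (hi k)))) := by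
  have h := pairSum_simpleRefl_right k (fun a => parity (j a)) (fun a => parity (i a))
  rw [sg, sg, ← pow_add]
  apply neg_one_pow_eq_of_cast_eq
  simp only [mul_add, pairSum_add, Function.comp_apply]
  have h' := congrArg (Nat.cast : ℕ → ZMod 2) h
  push_cast at h' ⊢
  linear_combination h' - (parity (j (lo k)) : ZMod 2) * parity (i (hi k)) * CharTwo.two_eq_zero (R := ZMod 2)

theorem sg_simpleRefl_right (k : Fin (r - 1)) (i j : Fin r → Fin (m + n)) :
    sg F i (j ∘ simpleRefl k) =
      sg F i j * (-1) ^ (parity (i (hi k)) * (parity (j (lo k)) + parity (j (hi k)))) := by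
  have h1 := pairSum_simpleRefl_both k (fun a => parity (j a)) (fun a => parity (j a))
  -- In the mixed sum only `j` moves. This is treated as moving `j` and `i s_k` together; `h3` then
  -- removes the `s_k` from `i`.
  have h2 := pairSum_simpleRefl_both k (fun a => parity (j a)) (fun a => parity (i (simpleRefl k a)))
  have h3 := pairSum_simpleRefl_right k (fun a => parity (j a)) (fun a => parity (i a))
  simp only [simpleRefl_simpleRefl, simpleRefl_lo, simpleRefl_hi] at h2
  rw [sg, sg, ← pow_add]
  apply neg_one_pow_eq_of_cast_eq
  simp only [mul_add, pairSum_add, Function.comp_apply]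
  have h1' := congrArg (Nat.cast : ℕ → ZMod 2) h1
  have h2' := congrArg (Nat.cast : ℕ → ZMod 2) h2
  have h3' := congrArg (Nat.cast : ℕ → ZMod 2) h3
  push_cast at h1' h2' h3' ⊢
  linear_combination h1' + h2' + h3' - (parity (j (lo k)) : ZMod 2) * (parity (i (hi k))) * CharTwo.two_eq_zero (R := ZMod 2)

end Coefficients

/-! ### Equivalence of the quadratic relations with commutation at two places. -/

section LocalRelations
variable {F : Type*} [Field F] (q : Fˣ) {m n : ℕ} {M : Type*} [AddCommGroup M] [Module F M]

/-- The defining relations of `𝒜_q(m|n)` for a family `X i j k l` in place of `x_{ij} x_{kl}`. -/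
structure QuadRel (X : Fin (m + n) → Fin (m + n) → Fin (m + n) → Fin (m + n) → M) : Prop where
  odd_sq (i j : Fin (m + n)) (h : parity i + parity j = 1) : X i j i j = 0
  row (i j k : Fin (m + n)) (h : j < k) :
    X i j i k = ((-1 : F) ^ ((parity i + parity j) * (parity i + parity k)) *
      (q : F) ^ ((-1 : ℤ) ^ (parity i + 1))) • X i k i j
  col (i j k : Fin (m + n)) (h : i < k) :
    X i j k j = ((-1 : F) ^ ((parity i + parity j) * (parity k + parity j)) *
      (q : F) ^ ((-1 : ℤ) ^ (parity j + 1))) • X k j i j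
  anti (i j k l : Fin (m + n)) (h : i < k) (h' : l < j) :
    X i j k l = (-1 : F) ^ ((parity i + parity j) * (parity k + parity l)) • X k l i j
  main (i j k l : Fin (m + n)) (h : i < k) (h' : j < l) :
    X i j k l = (-1 : F) ^ ((parity i + parity j) * (parity k + parity l)) • X k l i j +
      ((-1 : F) ^ (parity k * parity j + parity k * parity l + parity j * parity l) *
        ((q : F)⁻¹ - (q : F))) • X i l k j

/-- The relations expressing that a matrix commutes with a generator of the Hecke algebra. -/
def CommRel (X : Fin (m + n) → Fin (m + n) → Fin (m + n) → Fin (m + n) → M) : Prop :=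
  ∀ a b c d,
    (offCoef F a b * (-1) ^ (parity c * (parity a + parity b))) • X b c a d +
      diagCoef q a b • X a c b d =
    diagCoef q c d • X a c b d +
      (offCoef F c d * (-1) ^ (parity b * (parity c + parity d))) • X a d b c

variable {q}

theorem parity_cases (a : Fin (m + n)) :
    (a.1 < m ∧ parity a = 0) ∨ (¬ a.1 < m ∧ parity a = 1) := by
  by_cases h : a.1 < m
  · exact Or.inl ⟨h, parity_eq_zero h⟩
  · exact Or.inr ⟨h, parity_eq_one h⟩

/-- The relative orders of `a, b` and of `c, d` give nine cases, each covered by the defining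
relations for that configuration; enumerating parities settles the signs. The target is an arbitrary
module, so that the equivalence serves both for products in the algebra and for values of
functionals. -/
theorem QuadRel.commRel {X : Fin (m + n) → Fin (m + n) → Fin (m + n) → Fin (m + n) → M}
    (h : QuadRel q X) : CommRel q X := by
  intro a b c d
  have hq : (q : F) ≠ 0 := q.ne_zero
  have h44 : (-1 : F) ^ 4 = 1 := by norm_num
  rcases lt_trichotomy a b with hab | rfl | hab <;> rcases lt_trichotomy c d with hcd | rfl | hcd
  · have e := h.anti a d b c hab hcd
    simp only [offCoef, diagCoef, hab.ne, hcd.ne, hab, hcd, if_true, if_false, e]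
    rcases parity_cases a with ⟨-, h1⟩ | ⟨-, h1⟩ <;> rcases parity_cases b with ⟨-, h2⟩ | ⟨-, h2⟩ <;>
    rcases parity_cases c with ⟨-, h3⟩ | ⟨-, h3⟩ <;> rcases parity_cases d with ⟨-, h4⟩ | ⟨-, h4⟩ <;>
    simp [h44, h1, h2, h3, h4]
  · have e := h.col a c b hab
    simp only [offCoef, diagCoef, hab.ne, hab, lt_irrefl, if_true, if_false, e]
    rcases parity_cases a with ⟨-, h1⟩ | ⟨-, h1⟩ <;> rcases parity_cases b with ⟨-, h2⟩ | ⟨-, h2⟩ <;>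
    rcases parity_cases c with ⟨h3', h3⟩ | ⟨h3', h3⟩ <;>
    simp [h44, h1, h2, h3, h3', smul_smul, hq]
  · have e := h.main a d b c hab hcd
    simp only [offCoef, diagCoef, hab.ne, hcd.ne', hcd.not_gt, hab, if_true, if_false, e]
    rcases parity_cases a with ⟨-, h1⟩ | ⟨-, h1⟩ <;> rcases parity_cases b with ⟨-, h2⟩ | ⟨-, h2⟩ <;>
    rcases parity_cases c with ⟨-, h3⟩ | ⟨-, h3⟩ <;> rcases parity_cases d with ⟨-, h4⟩ | ⟨-, h4⟩ <;>
    simp [h44, h1, h2, h3, h4] <;> module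
  · have e := h.row a c d hcd
    simp only [offCoef, diagCoef, hcd.ne, hcd, lt_irrefl, if_true, if_false, e]
    rcases parity_cases a with ⟨h1', h1⟩ | ⟨h1', h1⟩ <;>
    rcases parity_cases c with ⟨-, h3⟩ | ⟨-, h3⟩ <;> rcases parity_cases d with ⟨-, h4⟩ | ⟨-, h4⟩ <;>
    simp [h44, h1, h1', h3, h4, smul_smul, hq]
  · by_cases hp : parity a + parity c = 1
    · simp only [h.odd_sq a c hp, smul_zero]
    · simp only [offCoef, diagCoef, lt_irrefl, if_true, if_false]
      rcases parity_cases a with ⟨h1', h1⟩ | ⟨h1', h1⟩ <;>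
      rcases parity_cases c with ⟨h3', h3⟩ | ⟨h3', h3⟩ <;>
      first | (exfalso; omega) | simp [h1', h3']
  · have e := h.row a d c hcd
    simp only [offCoef, diagCoef, hcd.ne', hcd.not_gt, lt_irrefl, if_true, if_false, e]
    rcases parity_cases a with ⟨h1', h1⟩ | ⟨h1', h1⟩ <;>
    rcases parity_cases c with ⟨-, h3⟩ | ⟨-, h3⟩ <;> rcases parity_cases d with ⟨-, h4⟩ | ⟨-, h4⟩ <;>
    simp [h44, h1, h1', h3, h4] <;> match_scalars <;> field_simp <;> ring
  -- The only case needing two relations: both `diagCoef q a b` and the term `X a d b c` are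
  -- present.
  · have e := h.main b c a d hab hcd
    have e' := h.anti b d a c hab hcd
    simp only [offCoef, diagCoef, hab.ne', hcd.ne, hab.not_gt, hcd, if_true, if_false, e, e']
    rcases parity_cases a with ⟨-, h1⟩ | ⟨-, h1⟩ <;> rcases parity_cases b with ⟨-, h2⟩ | ⟨-, h2⟩ <;>
    rcases parity_cases c with ⟨-, h3⟩ | ⟨-, h3⟩ <;> rcases parity_cases d with ⟨-, h4⟩ | ⟨-, h4⟩ <;>
    simp [h44, h1, h2, h3, h4] <;> module
  · have e := h.col b c a hab
    simp only [offCoef, diagCoef, hab.ne', hab.not_gt, lt_irrefl, if_true, if_false, e]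
    rcases parity_cases a with ⟨-, h1⟩ | ⟨-, h1⟩ <;> rcases parity_cases b with ⟨-, h2⟩ | ⟨-, h2⟩ <;>
    rcases parity_cases c with ⟨h3', h3⟩ | ⟨h3', h3⟩ <;>
    simp [h44, h1, h2, h3, h3'] <;> match_scalars <;> field_simp <;> ring
  · have e := h.anti b c a d hab hcd
    simp only [offCoef, diagCoef, hab.ne', hcd.ne', hab.not_gt, hcd.not_gt, if_false, e]
    rcases parity_cases a with ⟨-, h1⟩ | ⟨-, h1⟩ <;> rcases parity_cases b with ⟨-, h2⟩ | ⟨-, h2⟩ <;>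
    rcases parity_cases c with ⟨-, h3⟩ | ⟨-, h3⟩ <;> rcases parity_cases d with ⟨-, h4⟩ | ⟨-, h4⟩ <;>
    simp [h44, h1, h2, h3, h4] <;> module

/-- Each defining relation is one instance of commutation, solved for the required term. Only the
vanishing of odd squares uses `hq2`; elsewhere it suffices to invert signs and powers of `q`. -/
theorem CommRel.quadRel (hq2 : (q : F) + (q : F)⁻¹ ≠ 0)
    {X : Fin (m + n) → Fin (m + n) → Fin (m + n) → Fin (m + n) → M}
    (h : CommRel q X) : QuadRel q X := by
  have hq : (q : F) ≠ 0 := q.ne_zero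
  have h44 : (-1 : F) ^ 4 = 1 := by norm_num
  constructor
  · intro i j hp
    have e := h i i j j
    simp only [offCoef, diagCoef, lt_irrefl, if_true, if_false, zero_mul, zero_smul, zero_add,
      add_zero] at e
    -- Opposite parities make the two diagonal coefficients `q` and `-q⁻¹`.
    have key : ((q : F) + (q : F)⁻¹) • X i j i j = 0 := by
      rcases parity_cases i with ⟨h1', h1⟩ | ⟨h1', h1⟩ <;>
      rcases parity_cases j with ⟨h3', h3⟩ | ⟨h3', h3⟩ <;>
      simp only [h1, h3, h1', h3', if_true, if_false] at e hp
      · omega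
      · rw [add_smul, e]; module
      · rw [add_smul, ← e]; module
      · omega
    exact (smul_eq_zero.1 key).resolve_left hq2
  · intro i j k hjk
    have e := h i i j k
    simp only [offCoef, diagCoef, hjk, hjk.ne, lt_irrefl, if_true, if_false, zero_mul, zero_smul,
      zero_add] at e
    have e2 : X i j i k = (if i.1 < m then (q : F)⁻¹ else -(q : F)) •
        (if i.1 < m then (q : F) else -(q : F)⁻¹) • X i j i k := by
      rw [smul_smul]; split_ifs <;> simp [hq]
    rw [e2, e]
    rcases parity_cases i with ⟨h1', h1⟩ | ⟨h1', h1⟩ <;>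
    rcases parity_cases j with ⟨-, h3⟩ | ⟨-, h3⟩ <;> rcases parity_cases k with ⟨-, h4⟩ | ⟨-, h4⟩ <;>
    simp [h44, h1, h1', h3, h4]
  · intro i j k hik
    have e := h i k j j
    simp only [offCoef, diagCoef, hik, hik.ne, lt_irrefl, if_true, if_false, zero_mul, zero_smul,
      add_zero] at e
    have e2 : X i j k j = (if j.1 < m then (q : F)⁻¹ else -(q : F)) •
        (if j.1 < m then (q : F) else -(q : F)⁻¹) • X i j k j := by
      rw [smul_smul]; split_ifs <;> simp [hq]
    rw [e2, ← e]
    rcases parity_cases i with ⟨-, h1⟩ | ⟨-, h1⟩ <;>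
    rcases parity_cases j with ⟨h3', h3⟩ | ⟨h3', h3⟩ <;>
    rcases parity_cases k with ⟨-, h4⟩ | ⟨-, h4⟩ <;>
    simp [h44, h1, h3', h3, h4]
  · intro i j k l hik hlj
    have e := h i k l j
    simp only [offCoef, diagCoef, hik, hik.ne, hlj, hlj.ne, if_true, if_false, zero_smul,
      add_zero, zero_add] at e
    rcases parity_cases i with ⟨-, h1⟩ | ⟨-, h1⟩ <;> rcases parity_cases j with ⟨-, h2⟩ | ⟨-, h2⟩ <;>
    rcases parity_cases k with ⟨-, h3⟩ | ⟨-, h3⟩ <;> rcases parity_cases l with ⟨-, h4⟩ | ⟨-, h4⟩ <;>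
    simp [h44, h1, h2, h3, h4] at e ⊢ <;> simp [e]
  · intro i j k l hik hjl
    have e := h i k l j
    simp only [offCoef, diagCoef, hik, hik.ne, hjl.not_gt, hjl.ne', if_true, if_false, zero_smul,
      add_zero] at e
    have e2 : X i j k l = (-1 : F) ^ (parity l * parity j + parity k * (parity l + parity j)) •
      (((-1 : F) ^ (parity l * parity j) * (-1) ^ (parity k * (parity l + parity j))) •
        X i j k l) := by
      rw [smul_smul, ← pow_add, ← pow_add, ← two_mul, pow_mul]; simp
    rw [e2, ← sub_eq_iff_eq_add'.2 e]
    rcases parity_cases i with ⟨-, h1⟩ | ⟨-, h1⟩ <;> rcases parity_cases j with ⟨-, h2⟩ | ⟨-, h2⟩ <;>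
    rcases parity_cases k with ⟨-, h3⟩ | ⟨-, h3⟩ <;> rcases parity_cases l with ⟨-, h4⟩ | ⟨-, h4⟩ <;>
    simp [h44, h1, h2, h3, h4] <;> module

end LocalRelations

/-! ### Functionals on the degree `r` component as commuting matrices. -/

section DualPairing
variable {F : Type*} [Field F] (q : Fˣ) {m n r : ℕ}

theorem finRange_split (k : Fin (r - 1)) : ∃ A B : List (Fin r),
    List.finRange r = A ++ lo k :: hi k :: B ∧
      (∀ x ∈ A, x ≠ lo k ∧ x ≠ hi k) ∧ ∀ x ∈ B, x ≠ lo k ∧ x ≠ hi k := by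
  have h1 : k.1 < (List.finRange r).length := by rw [List.length_finRange]; omega
  have h2 : k.1 + 1 < (List.finRange r).length := by rw [List.length_finRange]; omega
  have e : List.finRange r = (List.finRange r).take k.1 ++ lo k :: hi k ::
      (List.finRange r).drop (k.1 + 1 + 1) := by
    conv_lhs => rw [← List.take_append_drop k.1 (List.finRange r),
      List.drop_eq_getElem_cons h1, List.drop_eq_getElem_cons h2]
    simp [lo, hi]
  refine ⟨_, _, e, ?_⟩
  have hn := List.nodup_finRange r
  rw [e] at hn
  generalize (List.finRange r).take k.1 = A at hn
  generalize (List.finRange r).drop (k.1 + 1 + 1) = B at hn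
  rw [List.nodup_append] at hn
  obtain ⟨-, hB, hAB⟩ := hn
  simp only [List.nodup_cons, List.mem_cons, not_or] at hB
  constructor
  · intro x hx
    exact ⟨hAB x hx _ (by simp), hAB x hx _ (by simp)⟩
  · intro x hx
    exact ⟨fun h => hB.1.2 (h ▸ hx), fun h => hB.2.1 (h ▸ hx)⟩

theorem QMat.quadRel : QuadRel q fun i j k l : Fin (m + n) => QMat.x q i j * QMat.x q k l := by
  constructor
  · intro i j h
    simpa [QMat.x] using RingQuot.mkAlgHom_rel F (MatRel.odd_sq (q := q) i j h)
  · intro i j k h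
    simpa [QMat.x] using RingQuot.mkAlgHom_rel F (MatRel.row (q := q) i j k h)
  · intro i j k h
    simpa [QMat.x] using RingQuot.mkAlgHom_rel F (MatRel.col (q := q) i j k h)
  · intro i j k l h h'
    simpa only [QMat.x, map_mul, map_smul] using
      RingQuot.mkAlgHom_rel F (MatRel.anti (q := q) i j k l h h')
  · intro i j k l h h'
    simpa only [QMat.x, map_mul, map_smul, map_add] using
      RingQuot.mkAlgHom_rel F (MatRel.main (q := q) i j k l h h')

/-- The same outer factors serve all words that agree away from places `lo k` and `hi k`, so a
degree two relation can be multiplied into context in one stroke. -/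
theorem QMat.mono_split (k : Fin (r - 1)) (i j : Fin r → Fin (m + n)) : ∃ P Q : QMat q m n,
    ∀ i' j' : Fin r → Fin (m + n), (∀ x, x ≠ lo k → x ≠ hi k → i' x = i x ∧ j' x = j x) →
      QMat.mono q i' j' =
        P * (QMat.x q (i' (lo k)) (j' (lo k)) * QMat.x q (i' (hi k)) (j' (hi k))) * Q := by
  obtain ⟨A, B, e, hA, hB⟩ := finRange_split k
  refine ⟨(A.map fun x => QMat.x q (i x) (j x)).prod, (B.map fun x => QMat.x q (i x) (j x)).prod,
    fun i' j' h => ?_⟩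
  have key : ∀ L : List (Fin r), (∀ x ∈ L, x ≠ lo k ∧ x ≠ hi k) →
      (L.map fun x => QMat.x q (i' x) (j' x)) = L.map fun x => QMat.x q (i x) (j x) := by
    intro L hL
    refine List.map_congr_left fun x hx => ?_
    obtain ⟨h1, h2⟩ := h x (hL x hx).1 (hL x hx).2
    rw [h1, h2]
  rw [QMat.mono, List.ofFn_eq_map, e]
  simp only [List.map_append, List.map_cons, List.prod_append, List.prod_cons, key A hA, key B hB,
    mul_assoc]

theorem xMono_commRel (k : Fin (r - 1)) (i j : Fin r → Fin (m + n)) :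
    (offCoef F (i (lo k)) (i (hi k)) *
        (-1) ^ (parity (j (lo k)) * (parity (i (lo k)) + parity (i (hi k))))) •
        xMono q (i ∘ simpleRefl k) j +
      diagCoef q (i (lo k)) (i (hi k)) • xMono q i j =
    diagCoef q (j (lo k)) (j (hi k)) • xMono q i j +
      (offCoef F (j (lo k)) (j (hi k)) *
        (-1) ^ (parity (i (hi k)) * (parity (j (lo k)) + parity (j (hi k))))) •
        xMono q i (j ∘ simpleRefl k) := by
  obtain ⟨P, Q, h⟩ := QMat.mono_split q k i j
  have h' := (QMat.quadRel q).commRel (i (lo k)) (i (hi k)) (j (lo k)) (j (hi k))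
  apply Subtype.ext
  simp only [xMono, Submodule.coe_add, Submodule.coe_smul]
  rw [h i j (by simp), h (i ∘ simpleRefl k) j (fun x h1 h2 => by simp [simpleRefl_of_ne h1 h2]),
    h i (j ∘ simpleRefl k) (fun x h1 h2 => by simp [simpleRefl_of_ne h1 h2])]
  simp only [Function.comp_apply, simpleRefl_lo, simpleRefl_hi]
  simpa only [mul_add, add_mul, mul_smul_comm, smul_mul_assoc] using
    congrArg (fun z => P * z * Q) h'

/-- This is the dictionary between functionals and matrices on which the whole argument rests. -/
theorem coef_dualAct (f : Module.Dual F (QMat.homog q m n r)) (i j : Fin r → Fin (m + n)) :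
    coef (dualAct q m n r f) i j = sg F i j * f (xMono q i j) := by
  simp [coef, dualAct, coact, sg, Finsupp.single_apply]

theorem dualAct_mem (f : Module.Dual F (QMat.homog q m n r)) :
    dualAct q m n r f ∈ schurSuper q m n r := by
  rw [mem_schurSuper_iff_coef]
  intro k i j
  simp only [coef_dualAct, sg_simpleRefl_left, sg_simpleRefl_right]
  have h := congrArg (fun z => sg F i j * f z) (xMono_commRel q k i j)
  simp only [map_add, map_smul, smul_eq_mul] at h
  linear_combination h

theorem span_xMono :
    Submodule.span F (Set.range fun p : (Fin r → Fin (m + n)) × (Fin r → Fin (m + n)) =>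
      xMono q p.1 p.2) = ⊤ := by
  apply Submodule.map_injective_of_injective (QMat.homog q m n r).injective_subtype
  rw [Submodule.map_span, ← Set.range_comp, Submodule.map_top, Submodule.range_subtype]
  rfl

theorem dual_ext {M : Type*} [AddCommMonoid M] [Module F M] {f g : QMat.homog q m n r →ₗ[F] M}
    (h : ∀ i j, f (xMono q i j) = g (xMono q i j)) : f = g :=
  LinearMap.ext_on (span_xMono q) (by rintro _ ⟨p, rfl⟩; exact h p.1 p.2)

theorem dualAct_injective : Function.Injective (dualAct q m n r) := by
  intro f g h
  refine dual_ext q fun i j => ?_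
  have := congrArg (fun φ => sg F i j * coef φ i j) h
  simpa only [coef_dualAct, ← mul_assoc, sg_mul_self, one_mul] using this

/-! ### Functionals on the homogeneous component -/

/-- The functional on words in the generators given by a matrix, up to the sign of the coaction. -/
def wordFun (a : (Fin r → Fin (m + n)) → (Fin r → Fin (m + n)) → F)
    (w : List (Fin (m + n) × Fin (m + n))) : F :=
  if h : w.length = r then
    sg F (fun k : Fin r => (w[k.1]'(by omega)).1) (fun k : Fin r => (w[k.1]'(by omega)).2) *
      a (fun k : Fin r => (w[k.1]'(by omega)).1) (fun k : Fin r => (w[k.1]'(by omega)).2)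
  else 0

theorem wordFun_ofFn (a : (Fin r → Fin (m + n)) → (Fin r → Fin (m + n)) → F)
    (i j : Fin r → Fin (m + n)) :
    wordFun a (List.ofFn fun k => (i k, j k)) = sg F i j * a i j := by
  simp [wordFun]

/-- Translates a marked adjacent pair in a list into a place `k = u.length`, so that exchanging row
or column letters there becomes composition with `s_k`. -/
theorem exists_ofFn_append {α β : Type*} (u v : List (α × β)) (a c : α) (b d : β)
    (h : (u ++ (a, b) :: (c, d) :: v).length = r) : ∃ (k : Fin (r - 1)) (i : Fin r → α)
      (j : Fin r → β), i (lo k) = a ∧ i (hi k) = c ∧ j (lo k) = b ∧ j (hi k) = d ∧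
      u ++ (a, b) :: (c, d) :: v = List.ofFn (fun x => (i x, j x)) ∧
      u ++ (c, b) :: (a, d) :: v = List.ofFn (fun x => ((i ∘ simpleRefl k) x, j x)) ∧
      u ++ (a, d) :: (c, b) :: v = List.ofFn (fun x => (i x, (j ∘ simpleRefl k) x)) := by
  have hk : u.length < r - 1 := by simp at h; omega
  subst h
  let w := u ++ (a, b) :: (c, d) :: v
  let k : Fin (w.length - 1) := ⟨u.length, hk⟩
  have hlo : w[u.length]'(by simp [w]) = (a, b) := by simp [w]
  have hhi : w[u.length + 1]'(by simp [w]) = (c, d) := by simp [w]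
  refine ⟨k, fun x => w[x.1].1, fun x => w[x.1].2, ?_, ?_, ?_, ?_, ?_, ?_, ?_⟩
  · exact congrArg Prod.fst hlo
  · exact congrArg Prod.fst hhi
  · exact congrArg Prod.snd hlo
  · exact congrArg Prod.snd hhi
  · exact (List.ofFn_getElem (xs := w)).symm
  all_goals
    refine List.ext_getElem (by simp [w]; omega) fun x h1 h2 => ?_
    rw [List.getElem_ofFn]
    have hx : x < w.length := by rwa [List.length_ofFn] at h2
    by_cases e1 : (⟨x, hx⟩ : Fin w.length) = lo k
    · have e1' : x = u.length := congrArg Fin.val e1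
      subst e1'
      simp only [Function.comp_apply, e1, simpleRefl_lo]
      simp [w, k, hi]
    by_cases e2 : (⟨x, hx⟩ : Fin w.length) = hi k
    · have e2' : x = u.length + 1 := congrArg Fin.val e2
      subst e2'
      simp only [Function.comp_apply, e2, simpleRefl_hi]
      simp [w, k, lo]
    simp only [Function.comp_apply, simpleRefl_of_ne e1 e2]
    have e1' : x ≠ u.length := fun h => e1 (Fin.ext h)
    have e2' : x ≠ u.length + 1 := fun h => e2 (Fin.ext h)
    simp only [w, List.getElem_append, List.getElem_cons]
    split_ifs <;> first | rfl | omega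

/-- In a fixed context `u, v` the commutation relation of `a` is the local one, because the sign
twist in `wordFun` absorbs the signs of `CommRel`. -/
theorem wordFun_commRel {a : (Fin r → Fin (m + n)) → (Fin r → Fin (m + n)) → F}
    (ha : IsCommuting q a) (u v : List (Fin (m + n) × Fin (m + n))) :
    CommRel q fun i j k l => wordFun a (u ++ (i, j) :: (k, l) :: v) := by
  intro x y c d
  by_cases h : (u ++ (x, c) :: (y, d) :: v).length = r
  · obtain ⟨k, i, j, rfl, rfl, rfl, rfl, h1, h2, h3⟩ := exists_ofFn_append u v x y c d h
    simp only [h1, h2, h3, wordFun_ofFn, sg_simpleRefl_left, sg_simpleRefl_right, smul_eq_mul]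
    have := ha k i j
    have sq : ∀ p : ℕ, (-1 : F) ^ p * (-1) ^ p = 1 := fun p => by
      rw [← pow_add, ← two_mul, pow_mul]; simp
    have s1 := sq (parity (j (lo k)) * (parity (i (lo k)) + parity (i (hi k))))
    have s2 := sq (parity (i (hi k)) * (parity (j (lo k)) + parity (j (hi k))))
    linear_combination sg F i j * this +
      sg F i j * offCoef F (i (lo k)) (i (hi k)) * a (i ∘ simpleRefl k) j * s1 -
      sg F i j * offCoef F (j (lo k)) (j (hi k)) * a i (j ∘ simpleRefl k) * s2
  -- The relations preserve degree, so extending the functional by zero to lengths other than `r` is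
  -- consistent.
  · have h0 : ∀ p p' : Fin (m + n) × Fin (m + n), wordFun a (u ++ p :: p' :: v) = 0 := by
      intro p p'
      rw [wordFun, dif_neg]
      simpa using h
    simp [h0]

/-- The monomial of the free algebra given by a word. -/
def freeWord (F : Type*) [Field F] {X : Type*} (w : List X) : FreeAlgebra F X :=
  (w.map (FreeAlgebra.ι F)).prod

theorem exists_freeWord_functional {X : Type*} (g : List X → F) :
    ∃ L : FreeAlgebra F X →ₗ[F] F, ∀ w, L (freeWord F w) = g w := by
  refine ⟨(FreeAlgebra.basisFreeMonoid F X).constr F fun w => g w.toList, fun w => ?_⟩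
  have e : freeWord F w = FreeAlgebra.basisFreeMonoid F X (FreeMonoid.ofList w) := by
    simp [FreeAlgebra.basisFreeMonoid, FreeAlgebra.equivMonoidAlgebraFreeMonoid, freeWord]
  rw [e, Module.Basis.constr_basis, FreeMonoid.toList_ofList]

theorem span_freeWord {X : Type*} :
    Submodule.span F (Set.range (freeWord F : List X → FreeAlgebra F X)) = ⊤ := by
  rw [eq_top_iff]
  rintro x -
  induction x using FreeAlgebra.induction with
  | grade0 c =>
    rw [Algebra.algebraMap_eq_smul_one]
    exact Submodule.smul_mem _ _ (Submodule.subset_span ⟨[], by simp [freeWord]⟩)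
  | grade1 x => exact Submodule.subset_span ⟨[x], by simp [freeWord]⟩
  | mul a b ha hb =>
    have := Submodule.mul_mem_mul ha hb
    rw [Submodule.span_mul_span] at this
    refine Submodule.span_mono ?_ this
    rintro _ ⟨_, ⟨u, rfl⟩, _, ⟨v, rfl⟩, rfl⟩
    exact ⟨u ++ v, by simp [freeWord]⟩
  | add a b ha hb => exact add_mem ha hb

theorem apply_mul_mul_eq {X : Type*} (L : FreeAlgebra F X →ₗ[F] F) {x y : FreeAlgebra F X}
    (h : ∀ u v, L (freeWord F u * x * freeWord F v) = L (freeWord F u * y * freeWord F v))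
    (u v : FreeAlgebra F X) : L (u * x * v) = L (u * y * v) := by
  have hu : u ∈ Submodule.span F (Set.range (freeWord F : List X → FreeAlgebra F X)) := by
    rw [span_freeWord]; trivial
  have hv : v ∈ Submodule.span F (Set.range (freeWord F : List X → FreeAlgebra F X)) := by
    rw [span_freeWord]; trivial
  induction hu using Submodule.span_induction with
  | mem u hu =>
    obtain ⟨u, rfl⟩ := hu
    induction hv using Submodule.span_induction with
    | mem v hv => obtain ⟨v, rfl⟩ := hv; exact h u v
    | zero => simp
    | add v v' _ _ h1 h2 => rw [mul_add, mul_add, map_add, map_add, h1, h2]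
    | smul c v _ h1 => rw [mul_smul_comm, mul_smul_comm, map_smul, map_smul, h1]
  | zero => simp
  | add u u' _ _ h1 h2 => simp only [add_mul, map_add, h1, h2]
  | smul c u _ h1 => simp only [smul_mul_assoc, map_smul, h1]

/-- A functional on an algebra that is insensitive to relations placed in any context factors
through the quotient by these relations. -/
theorem apply_eq_zero_of_mkAlgHom_eq_zero {A : Type*} [Ring A] [Algebra F A] {rel : A → A → Prop}
    (L : A →ₗ[F] F) (h : ∀ x y, rel x y → ∀ u v, L (u * x * v) = L (u * y * v)) {x : A}
    (hx : RingQuot.mkAlgHom F rel x = 0) : L x = 0 := by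
  -- Being indistinguishable by `L` in every context is a ring congruence containing `rel`; hence
  -- `RingQuot rel` maps to its quotient.
  let c : RingCon A :=
    { r := fun x y => ∀ u v, L (u * x * v) = L (u * y * v)
      iseqv := ⟨fun _ _ _ => rfl, fun h u v => (h u v).symm, fun h h' u v => (h u v).trans (h' u v)⟩
      mul' := by
        intro w x y z h1 h2 u v
        have e1 := h1 u (y * v)
        have e2 := h2 (u * x) v
        simp only [mul_assoc] at e1 e2 ⊢
        rw [e1, e2]
      add' := by
        intro w x y z h1 h2 u v
        simp only [mul_add, add_mul, map_add, h1 u v, h2 u v] }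
  let π : RingQuot rel →ₐ[F] c.Quotient :=
    RingQuot.liftAlgHom F ⟨c.mkₐ F, fun x y hxy => (RingCon.eq c).2 (h x y hxy)⟩
  have h1 : π (RingQuot.mkAlgHom F rel x) = c.mkₐ F x :=
    RingQuot.liftAlgHom_mkAlgHom_apply F _ _ _
  rw [hx, map_zero, ← map_zero (c.mkₐ F)] at h1
  have h2 := (RingCon.eq c).1 h1 1 1
  simpa using h2.symm

/-- Surjectivity onto commuting matrices. The functional is prescribed freely on words of the free
algebra; since it respects every relation in every context, it descends to the quotient and is then
restricted to degree `r`. -/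
theorem exists_functional (hq2 : (q : F) + (q : F)⁻¹ ≠ 0)
    {a : (Fin r → Fin (m + n)) → (Fin r → Fin (m + n)) → F} (ha : IsCommuting q a) :
    ∃ f : Module.Dual F (QMat.homog q m n r), ∀ i j, f (xMono q i j) = sg F i j * a i j := by
  obtain ⟨L, hL⟩ := exists_freeWord_functional (wordFun a)
  have hrel : ∀ x y, MatRel q m n x y → ∀ u v, L (u * x * v) = L (u * y * v) := by
    intro x y hxy u v
    refine apply_mul_mul_eq L (fun u v => ?_) u v
    have hR := (wordFun_commRel q ha u v).quadRel hq2
    have e : ∀ i j k l, L (freeWord F u * (FreeAlgebra.ι F (i, j) * FreeAlgebra.ι F (k, l)) *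
        freeWord F v) = wordFun a (u ++ (i, j) :: (k, l) :: v) := by
      intro i j k l
      rw [← hL]
      simp [freeWord, mul_assoc]
    induction hxy with
    | odd_sq i j h => rw [e, hR.odd_sq i j h]; simp
    | row i j k h => rw [mul_smul_comm, smul_mul_assoc, map_smul, e, e, hR.row i j k h]
    | col i j k h => rw [mul_smul_comm, smul_mul_assoc, map_smul, e, e, hR.col i j k h]
    | anti i j k l h h' =>
      rw [mul_smul_comm, smul_mul_assoc, map_smul, e, e, hR.anti i j k l h h']
    | main i j k l h h' =>
      rw [mul_add, add_mul, map_add, mul_smul_comm, smul_mul_assoc, map_smul, mul_smul_comm,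
        smul_mul_assoc, map_smul, e, e, e, hR.main i j k l h h']
  set π := RingQuot.mkAlgHom F (MatRel q m n) with hπ
  have hsurj : Function.Surjective π.toLinearMap := RingQuot.mkAlgHom_surjective F _
  have hker : LinearMap.ker π.toLinearMap ≤ LinearMap.ker L := fun x hx =>
    apply_eq_zero_of_mkAlgHom_eq_zero L hrel hx
  let f : QMat q m n →ₗ[F] F := (LinearMap.ker π.toLinearMap).liftQ L hker ∘ₗ
    (π.toLinearMap.quotKerEquivOfSurjective hsurj).symm.toLinearMap
  have hf : ∀ x, f (π x) = L x := by
    intro x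
    have : (π.toLinearMap.quotKerEquivOfSurjective hsurj).symm (π x) =
        Submodule.Quotient.mk x := by
      rw [LinearEquiv.symm_apply_eq]; rfl
    simp [f, this]
  refine ⟨f ∘ₗ (QMat.homog q m n r).subtype, fun i j => ?_⟩
  rw [← wordFun_ofFn, ← hL, ← hf]
  simp only [LinearMap.comp_apply, Submodule.subtype_apply, xMono, QMat.mono, freeWord,
    map_list_prod, List.map_ofFn]
  rfl

theorem range_dualAct (hq2 : (q : F) + (q : F)⁻¹ ≠ 0) :
    LinearMap.range (dualAct q m n r) = Subalgebra.toSubmodule (schurSuper q m n r) := by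
  apply le_antisymm
  · rintro _ ⟨f, rfl⟩
    exact dualAct_mem q f
  · intro φ hφ
    obtain ⟨f, hf⟩ := exists_functional q hq2
      ((mem_schurSuper_iff_coef q).1 ((Subalgebra.mem_toSubmodule _).1 hφ))
    refine ⟨f, coef_ext fun i j => ?_⟩
    rw [coef_dualAct, hf, ← mul_assoc, sg_mul_self, one_mul]

end DualPairing

/-! ### Standard pairs of words: straightening, and entries of the relative norms. -/

section StandardPairs
variable {F : Type*} [Field F] (q : Fˣ) {m n r : ℕ}

/-- The word of pairs of letters, ordered lexicographically. -/
def pairWord (i j : Fin r → Fin (m + n)) : Fin r → Fin (m + n) ×ₗ Fin (m + n) :=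
  fun k => toLex (i k, j k)

theorem pairWord_eq_iff {i j : Fin r → Fin (m + n)} {k l : Fin r} :
    pairWord i j k = pairWord i j l ↔ i k = i l ∧ j k = j l := by
  simp [pairWord]

theorem monotone_pairWord_iff {i j : Fin r → Fin (m + n)} : Monotone (pairWord i j) ↔
    Monotone i ∧ ∀ k l, k ≤ l → i k = i l → j k ≤ j l := by
  simp only [Monotone, pairWord, Prod.Lex.toLex_le_toLex]
  constructor
  · intro h
    exact ⟨fun a b hab => (h hab).elim le_of_lt fun h => h.1.le, fun k l hkl he =>
      (h hkl).elim (fun h => absurd he h.ne) fun h => h.2⟩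
  · rintro ⟨h1, h2⟩ a b hab
    rcases (h1 hab).lt_or_eq with h | h
    · exact Or.inl h
    · exact Or.inr ⟨h, h2 a b hab h⟩

/-- Pairs of words indexing the standard monomials: the pairs of letters are weakly increasing in
the lexicographic order and pairs of letters of opposite parity are not repeated. -/
def IsStandard (i j : Fin r → Fin (m + n)) : Prop :=
  Monotone (pairWord i j) ∧
    ∀ k l, k ≠ l → pairWord i j k = pairWord i j l → parity (i k) = parity (j k)

/-- A matrix commuting with the action of the Hecke algebra is determined by its entries at
standard pairs. -/
theorem IsCommuting.eq_zero (hq2 : (q : F) + (q : F)⁻¹ ≠ 0)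
    {a : (Fin r → Fin (m + n)) → (Fin r → Fin (m + n)) → F} (ha : IsCommuting q a)
    (h0 : ∀ i j, IsStandard i j → a i j = 0) (i j : Fin r → Fin (m + n)) : a i j = 0 := by
  have off_ne : ∀ x y : Fin (m + n), x ≠ y → offCoef F x y ≠ 0 := fun x y h =>
    left_ne_zero_of_mul (offCoef_sq (F := F) x y h ▸ one_ne_zero)
  induction hci : (inversions i).card using Nat.strong_induction_on generalizing i j with
  | _ N ih =>
  by_cases hmono : Monotone i
  · induction hcj : (inversions j).card using Nat.strong_induction_on generalizing j with
    | _ N' ih' =>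
    -- With equal row letters the off-diagonal row term vanishes, and the relation at `(i, j s_k)`
    -- makes `a i j` a multiple of an entry with fewer inversions in `j`.
    by_cases hs : ∃ k, i (lo k) = i (hi k) ∧ j (hi k) < j (lo k)
    · obtain ⟨k, h1, h2⟩ := hs
      have e := ha k i (j ∘ simpleRefl k)
      have h3 := card_inversions_comp_of_gt h2
      rw [ih' _ (by omega) (j ∘ simpleRefl k) rfl] at e
      rw [comp_simpleRefl_comp, h1] at e
      have hz : offCoef F (i (hi k)) (i (hi k)) = 0 := by simp [offCoef]
      rw [hz] at e
      simp only [Function.comp_apply, simpleRefl_lo, simpleRefl_hi, zero_mul, mul_zero,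
        add_zero, zero_add] at e
      exact (mul_eq_zero.1 e.symm).resolve_left (off_ne _ _ h2.ne)
    · push Not at hs
      have hlex : Monotone (pairWord i j) := by
        by_contra hcon
        obtain ⟨k, hk⟩ := exists_adjacent_of_not_monotone hcon
        rw [pairWord, pairWord, Prod.Lex.toLex_lt_toLex] at hk
        rcases hk with hk | ⟨h1, h2⟩
        · exact absurd (hmono (lo_lt_hi k).le) hk.not_ge
        · exact absurd (hs k h1.symm) h2.not_ge
      by_cases hst : IsStandard i j
      · exact h0 i j hst
      · rw [IsStandard, not_and] at hst
        have := hst hlex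
        push Not at this
        obtain ⟨x, y, hxy, he, hp⟩ := this
        -- Equal pairs in a sorted word fill an interval, so a repetition already occurs at `x` and
        -- the next place.
        wlog hlt : x < y generalizing x y
        · refine this y x hxy.symm he.symm ?_ (lt_of_le_of_ne (not_lt.1 hlt) hxy.symm)
          rw [pairWord_eq_iff] at he
          rwa [← he.1, ← he.2]
        have hlt' : x.1 < y.1 := hlt
        let k : Fin (r - 1) := ⟨x.1, by omega⟩
        have hx : x = lo k := rfl
        have hy : hi k ≤ y := by rw [Fin.le_def]; simp [hi, k]; omega
        have hk : pairWord i j (lo k) = pairWord i j (hi k) :=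
          le_antisymm (hlex (lo_lt_hi k).le) (by rw [← hx, he]; exact hlex hy)
        rw [pairWord_eq_iff] at hk
        have e := ha k i j
        rw [hx] at hp
        rw [← hk.1, ← hk.2] at e
        simp only [offCoef, diagCoef, lt_irrefl, if_true, if_false, zero_mul, zero_add,
          add_zero] at e
        have key : ((q : F) + (q : F)⁻¹) * a i j = 0 := by
          rcases parity_cases (i (lo k)) with ⟨h1, h1'⟩ | ⟨h1, h1'⟩ <;>
          rcases parity_cases (j (lo k)) with ⟨h2, h2'⟩ | ⟨h2, h2'⟩ <;>
          simp only [h1, h2, if_true, if_false] at e <;>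
          first | (exfalso; omega) | linear_combination e | linear_combination -e
        exact (mul_eq_zero.1 key).resolve_left hq2
  -- The relation at `(i s_k, j)` expresses `a i j` through entries whose row word is `i s_k`, which
  -- has fewer inversions.
  · obtain ⟨k, hk⟩ := exists_adjacent_of_not_monotone hmono
    have h3 := card_inversions_comp_of_gt hk
    have e := ha k (i ∘ simpleRefl k) j
    rw [ih _ (by omega) (i ∘ simpleRefl k) j rfl, ih _ (by omega) (i ∘ simpleRefl k) _ rfl,
      comp_simpleRefl_comp] at e
    simp only [Function.comp_apply, simpleRefl_lo, simpleRefl_hi, mul_zero, add_zero] at e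
    exact (mul_eq_zero.1 e).resolve_left (off_ne _ _ hk.ne)

/-- If `j` does not decrease along the inversions of `w⁻¹`, then `v_j 𝒯_w` is a multiple of
`v_{jw}`. -/
theorem exists_opT_vBasis_eq (w : Equiv.Perm (Fin r)) (j : Fin r → Fin (m + n))
    (h : ∀ a b, a < b → w⁻¹ b < w⁻¹ a → j a ≤ j b) :
    ∃ c : F, opT q m n w (vBasis F m n r j) = c • vBasis F m n r (j ∘ w) := by
  induction hN : len w generalizing w with
  | zero =>
    obtain rfl := eq_one_of_len_eq_zero hN
    exact ⟨1, by rw [opT_one]; simp⟩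
  | succ N ih =>
    have hne : ¬ Monotone w := by
      intro hmono
      have h1 := Tuple.unique_monotone (f := id) (σ := w) (τ := 1) hmono monotone_id
      have h2 : w = 1 := DFunLike.coe_injective h1
      rw [h2, len_one] at hN
      omega
    obtain ⟨k, hk⟩ := exists_adjacent_of_not_monotone hne
    obtain ⟨u, rfl⟩ : ∃ u, w = u * simpleRefl k := ⟨w * simpleRefl k, by simp⟩
    have hu : u (lo k) < u (hi k) := by simpa using hk
    have hinv : ∀ x, u⁻¹ (u x) = x := u.symm_apply_apply
    have hj : j (u (lo k)) ≤ j (u (hi k)) := by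
      refine h _ _ hu ?_
      simp only [mul_inv_rev, simpleRefl_inv, Equiv.Perm.mul_apply, hinv, simpleRefl_lo,
        simpleRefl_hi]
      exact lo_lt_hi k
    obtain ⟨c, hc⟩ := ih u (fun a b hab hu' => by
      refine h a b hab ?_
      simp only [mul_inv_rev, simpleRefl_inv, Equiv.Perm.mul_apply]
      refine simpleRefl_lt hu' ?_
      rintro ⟨h1, h2⟩
      have h1' : b = u (lo k) := by rw [← h1]; simp
      have h2' : a = u (hi k) := by rw [← h2]; simp
      rw [h1', h2'] at hab
      exact absurd hab hu.not_gt) (by rw [len_mul_simpleRefl hu] at hN; omega)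
    rw [opT_mul_simpleRefl q hu, Module.End.mul_apply, hc, map_smul, genOp_basis]
    change ∃ c' : F, c • (offCoef F (j (u (lo k))) (j (u (hi k))) •
      vBasis F m n r (j ∘ u ∘ simpleRefl k) +
      diagCoef q (j (u (lo k))) (j (u (hi k))) • vBasis F m n r (j ∘ u)) =
      c' • vBasis F m n r (j ∘ u ∘ simpleRefl k)
    -- For increasing letters the diagonal term vanishes; for equal letters `s_k` fixes the word and
    -- both terms are multiples of the same basis tensor.
    rcases hj.lt_or_eq with hlt | heq
    · refine ⟨c * offCoef F (j (u (lo k))) (j (u (hi k))), ?_⟩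
      rw [show diagCoef q (j (u (lo k))) (j (u (hi k))) = 0 by simp [diagCoef, hlt]]
      rw [zero_smul, add_zero, smul_smul]
    · have := comp_simpleRefl_self k (j ∘ u) heq
      rw [show j ∘ u ∘ simpleRefl k = j ∘ u from this, ← add_smul, smul_smul]
      exact ⟨_, rfl⟩

theorem coef_mul_matUnit_mul (A B : Module.End F (TensorSpace F m n r))
    (i j i' j' : Fin r → Fin (m + n)) :
    coef (A * matUnit F i j * B) i' j' = coef B i' i * coef A j j' := by
  have h : ∀ v, matUnit F i j v = (vBasis F m n r).repr v i • vBasis F m n r j := by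
    intro v
    have : matUnit F i j = ((vBasis F m n r).coord i).smulRight (vBasis F m n r j) := by
      refine (vBasis F m n r).ext fun i' => ?_
      simp [matUnit, Finsupp.single_apply]
    rw [this]; rfl
  rw [coef, Module.End.mul_apply, Module.End.mul_apply, h, map_smul, map_smul]
  rfl

/-- A repeated pair has letters of equal parity, so the generator scales `v_i` and `v_j` by the same
eigenvalue; by symmetry of its matrix it also scales the coordinate functional of `v_i`. -/
theorem matUnit_commute {i j : Fin r → Fin (m + n)} (h : IsStandard i j) {t : Fin (r - 1)}
    (ht : pairWord i j (lo t) = pairWord i j (hi t)) :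
    genOp q m n t * matUnit F i j = matUnit F i j * genOp q m n t := by
  have hp := h.2 _ _ (lo_ne_hi t) ht
  rw [pairWord_eq_iff] at ht
  have e1 := comp_simpleRefl_self t i ht.1
  have e2 := comp_simpleRefl_self t j ht.2
  have hd : diagCoef q (j (lo t)) (j (lo t)) = diagCoef q (i (lo t)) (i (lo t)) := by
    simp only [diagCoef, lt_irrefl, if_false, if_true]
    rcases parity_cases (i (lo t)) with ⟨h1, h1'⟩ | ⟨h1, h1'⟩ <;>
    rcases parity_cases (j (lo t)) with ⟨h2, h2'⟩ | ⟨h2, h2'⟩ <;>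
    simp only [h1, h2, if_true, if_false] <;> (exfalso; omega)
  have hz : ∀ x : Fin (m + n), offCoef F x x = 0 := fun x => by simp [offCoef]
  have hm : ∀ i' j', coef (matUnit F i j) i' j' = if i' = i ∧ j' = j then 1 else 0 := by
    intro i' j'
    rw [coef, matUnit, Module.Basis.constr_basis]
    by_cases h1 : i' = i
    · rw [if_pos h1, Module.Basis.repr_self, Finsupp.single_apply]
      simp [h1, eq_comm]
    · simp [h1]
  refine coef_ext fun i' j' => ?_
  have hsw : ∀ l : Fin r → Fin (m + n), l ∘ simpleRefl t = l → ∀ l', l' ∘ simpleRefl t = l ↔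
      l' = l := by
    intro l hl l'
    constructor
    · intro h'
      rw [← comp_simpleRefl_comp l' t, h', hl]
    · rintro rfl; exact hl
  have lhs : coef (genOp q m n t * matUnit F i j) i' j' =
      offCoef F (j' (lo t)) (j' (hi t)) * coef (matUnit F i j) i' (j' ∘ simpleRefl t) +
      diagCoef q (j' (lo t)) (j' (hi t)) * coef (matUnit F i j) i' j' := by
    rw [coef, Module.End.mul_apply, repr_genOp]; rfl
  have rhs : coef (matUnit F i j * genOp q m n t) i' j' =
      offCoef F (i' (lo t)) (i' (hi t)) * coef (matUnit F i j) (i' ∘ simpleRefl t) j' +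
      diagCoef q (i' (lo t)) (i' (hi t)) * coef (matUnit F i j) i' j' := by
    rw [coef, Module.End.mul_apply, genOp_basis]
    simp only [map_add, map_smul, Finsupp.add_apply, Finsupp.smul_apply, smul_eq_mul]; rfl
  rw [lhs, rhs]
  simp only [hm, hsw i e1, hsw j e2]
  split_ifs with hc
  · obtain ⟨rfl, rfl⟩ := hc
    rw [← ht.1, ← ht.2, hz, hz, hd]
  · simp

theorem relNorm_matUnit_mem {i j : Fin r → Fin (m + n)} (h : IsStandard i j) :
    relNorm q (wordStab (pairWord i j)) (matUnit F i j) ∈ schurSuper q m n r :=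
  relNorm_mem_schurSuper q h.1 fun _ ht => matUnit_commute q h ht

/-- Only the summand `w = 1` can contribute. Sortedness makes `𝒯_{w⁻¹}` and then `𝒯_w` act on the
relevant basis tensors by permuting letters up to a scalar; a nonzero entry thus forces `i' = i`,
then `j' = j` with `w` in the stabilizer, whose only shortest representative is `1`. -/
theorem coef_relNorm {i j i' j' : Fin r → Fin (m + n)} (h : IsStandard i j)
    (h' : IsStandard i' j') :
    coef (relNorm q (wordStab (pairWord i j)) (matUnit F i j)) i' j' =
      if i' = i ∧ j' = j then 1 else 0 := by
  classical
  have hi := (monotone_pairWord_iff.1 h.1).1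
  have hi' := (monotone_pairWord_iff.1 h'.1).1
  have hsum : ∀ (s : Finset (Equiv.Perm (Fin r)))
      (g : Equiv.Perm (Fin r) → Module.End F (TensorSpace F m n r)),
      coef (∑ w ∈ s, g w) i' j' = ∑ w ∈ s, coef (g w) i' j' := by
    intro s g
    simp [coef, LinearMap.sum_apply, Finsupp.finsetSum_apply]
  rw [relNorm_eq, hsum]
  simp only [coef_mul_matUnit_mul]
  have zero : ∀ w ∈ distinguished (wordStab (pairWord i j)), ¬ (w = 1 ∧ i' = i ∧ j' = j) →
      coef (opT q m n w⁻¹) i' i * coef (opT q m n w) j j' = 0 := by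
    intro w hw hne
    by_contra hcon
    have hn1 := left_ne_zero_of_mul hcon
    have hn2 := right_ne_zero_of_mul hcon
    obtain ⟨c, hc⟩ := exists_opT_vBasis_eq q w⁻¹ i' fun a b hab _ => hi' hab.le
    have e1 : i' ∘ (w⁻¹ : Equiv.Perm (Fin r)) = i := by
      by_contra hx
      rw [coef, hc, map_smul, Module.Basis.repr_self, Finsupp.smul_apply, Finsupp.single_apply,
        if_neg hx, smul_zero] at hn1
      exact hn1 rfl
    have ei : i' = i := by
      have := Tuple.unique_monotone (f := i') (σ := w⁻¹) (τ := 1) (e1 ▸ hi) hi'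
      rw [← e1, this]; rfl
    subst ei
    have hwi : ∀ x, i' (w⁻¹ x) = i' x := fun x => congrFun e1 x
    -- Since `w` stabilizes the sorted word `i'`, an inversion of `w⁻¹` joins places with equal row
    -- letters, and there `j` is weakly increasing.
    obtain ⟨c', hc'⟩ := exists_opT_vBasis_eq q w j fun a b hab hinv => by
      refine (monotone_pairWord_iff.1 h.1).2 a b hab.le (le_antisymm (hi hab.le) ?_)
      rw [← hwi a, ← hwi b]
      exact hi hinv.le
    have e2 : j ∘ w = j' := by
      by_contra hx
      rw [coef, hc', map_smul, Module.Basis.repr_self, Finsupp.smul_apply, Finsupp.single_apply,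
        if_neg hx, smul_zero] at hn2
      exact hn2 rfl
    have e3 : pairWord i' j ∘ w = pairWord i' j' := by
      funext x
      have := hwi (w x)
      rw [show w⁻¹ (w x) = x from w.symm_apply_apply x] at this
      simp [pairWord, ← e2, this]
    -- Two sorted rearrangements of one word of pairs coincide.
    have e4 := Tuple.unique_monotone (f := pairWord i' j) (σ := w) (τ := 1) (e3 ▸ h'.1) h.1
    have e5 : pairWord i' j' = pairWord i' j := by rw [← e3, e4]; rfl
    have ej : j' = j := funext fun x => by
      have := congrArg (fun z => (ofLex z).2) (congrFun e5 x)
      simpa [pairWord] using this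
    have hw1 : w = 1 := by
      exact eq_one_of_mem_distinguished hw fun x => congrFun (e3.trans e5) x
    exact hne ⟨hw1, rfl, ej⟩
  have h1 : (1 : Equiv.Perm (Fin r)) ∈ distinguished (wordStab (pairWord i j)) := fun u _ => by
    rw [len_one]; exact Nat.zero_le _
  split_ifs with hc
  · rw [Finset.sum_eq_single 1]
    · obtain ⟨rfl, rfl⟩ := hc
      simp [opT_one, coef]
    · intro w hw hne
      exact zero w (Finset.mem_filter.1 hw).2 fun h => hne h.1
    · intro hn
      exact absurd (Finset.mem_filter.2 ⟨Finset.mem_univ _, h1⟩) hn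
  · exact Finset.sum_eq_zero fun w hw =>
      zero w (Finset.mem_filter.1 hw).2 fun h => hc h.2

end StandardPairs

/-! ### Triples `(λ, μ, d)` correspond to standard pairs. -/

section Triples
variable {m n r : ℕ}

theorem sum_castLE_eq_sum_Iio {N : ℕ} (f : Fin N → ℕ) (a : Fin N) :
    ∑ i : Fin a.1, f (Fin.castLE a.2.le i) = ∑ c ∈ Finset.Iio a, f c := by
  refine Finset.sum_nbij (Fin.castLE a.2.le) ?_ ?_ ?_ fun _ _ => rfl
  · exact fun i _ => Finset.mem_Iio.2 i.2
  · exact fun x _ y _ h => Fin.castLE_injective _ h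
  · intro c hc
    have hc' : c < a := Finset.mem_Iio.1 hc
    exact ⟨⟨c.1, hc'⟩, Finset.mem_coe.2 (Finset.mem_univ _), rfl⟩

theorem Lam.monotone_word (lam : Lam m n r) : Monotone lam.word := by
  intro k l hkl
  by_contra hcon
  rw [not_le] at hcon
  unfold Lam.word at hcon
  have hk := finSigmaFinEquiv.apply_symm_apply (Fin.cast lam.2.symm k)
  have hl := finSigmaFinEquiv.apply_symm_apply (Fin.cast lam.2.symm l)
  set x := finSigmaFinEquiv.symm (Fin.cast lam.2.symm k)
  set y := finSigmaFinEquiv.symm (Fin.cast lam.2.symm l)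
  have hk' := congrArg Fin.val hk
  have hl' := congrArg Fin.val hl
  rw [finSigmaFinEquiv_apply, Fin.val_cast] at hk' hl'
  -- If the letter at `l` were smaller than that at `k`, its block would end before the block of `k`
  -- begins, contradicting `k ≤ l`.
  have key : ∑ i : Fin y.1.1, lam.1 (Fin.castLE y.1.2.le i) + lam.1 y.1 ≤
      ∑ i : Fin x.1.1, lam.1 (Fin.castLE x.1.2.le i) := by
    rw [sum_castLE_eq_sum_Iio, sum_castLE_eq_sum_Iio, add_comm,
      ← Finset.sum_insert (by simp), Finset.Iio_insert]
    refine Finset.sum_le_sum_of_subset fun c hc => ?_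
    rw [Finset.mem_Iic] at hc
    exact Finset.mem_Iio.2 (hc.trans_lt hcon)
  have := y.2.2
  rw [Fin.le_def] at hkl
  omega

/-- The places of a letter in the word of a composition. -/
def Lam.fiberEquiv (lam : Lam m n r) (a : Fin (m + n)) :
    {k // lam.word k = a} ≃ Fin (lam.1 a) :=
  ((finCongr lam.2.symm).trans finSigmaFinEquiv.symm |>.subtypeEquiv (q := fun x => x.1 = a)
    fun _ => Iff.rfl).trans (Equiv.sigmaSubtype a)

theorem Lam.word_injective : Function.Injective (Lam.word : Lam m n r → _) := by
  intro lam lam' h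
  refine Subtype.ext (funext fun a => ?_)
  have e := ((lam.fiberEquiv a).symm.trans
    ((Equiv.subtypeEquivRight fun k => by rw [h]).trans (lam'.fiberEquiv a)))
  exact Fin.equiv_iff_eq.1 ⟨e⟩

/-- The parts count the occurrences of each letter; the resulting word is a sorted rearrangement of
`i`, hence equal to it. -/
theorem exists_word_eq {i : Fin r → Fin (m + n)} (hi : Monotone i) :
    ∃ lam : Lam m n r, lam.word = i := by
  let c : Fin (m + n) → ℕ := fun a => Fintype.card {k // i k = a}
  have hc : ∑ a, c a = r := by
    have := Fintype.card_congr (Equiv.sigmaFiberEquiv i)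
    rw [Fintype.card_sigma, Fintype.card_fin] at this
    exact this
  let lam : Lam m n r := ⟨c, hc⟩
  let e : ∀ a, Fin (c a) ≃ {k // i k = a} := fun a => (Fintype.equivFin _).symm
  let σ : Equiv.Perm (Fin r) := ((finCongr hc.symm).trans finSigmaFinEquiv.symm).trans
    ((Equiv.sigmaCongrRight e).trans (Equiv.sigmaFiberEquiv i))
  have hσ : i ∘ σ = lam.word := funext fun k => (e _ _).2
  refine ⟨lam, ?_⟩
  have := Tuple.unique_monotone (f := i) (σ := σ) (τ := 1) (hσ ▸ lam.monotone_word) hi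
  rw [← hσ, this]; rfl

theorem Lam.young_eq (lam : Lam m n r) : lam.young = wordStab lam.word := rfl

theorem mem_conjBy {W' : Subgroup (Equiv.Perm (Fin r))} {d u : Equiv.Perm (Fin r)} :
    u ∈ conjBy W' d ↔ d * u * d⁻¹ ∈ W' := by
  rw [conjBy, Subgroup.mem_map]
  constructor
  · rintro ⟨x, hx, rfl⟩
    simpa [mul_assoc] using hx
  · intro h
    exact ⟨_, h, by simp [mul_assoc]⟩

theorem mem_conjBy_young {lam : Lam m n r} {d u : Equiv.Perm (Fin r)} :
    u ∈ conjBy lam.young d ↔ ∀ k, lam.word (d (u k)) = lam.word (d k) := by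
  rw [mem_conjBy]
  constructor
  · intro h k
    have := h (d k)
    simpa using this
  · intro h k
    have := h (d⁻¹ k)
    simpa using this

theorem mem_conjBy_youngPart {lam : Lam m n r} {d u : Equiv.Perm (Fin r)} {e : ℕ} :
    u ∈ conjBy (lam.youngPart e) d ↔ (∀ k, lam.word (d (u k)) = lam.word (d k)) ∧
      ∀ k, parity (lam.word (d k)) ≠ e → u k = k := by
  rw [← mem_conjBy_young, mem_conjBy, mem_conjBy]
  refine and_congr_right fun _ => ?_
  constructor
  · intro h k hk
    have := h (d k) hk
    simpa using this
  · intro h k hk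
    have := h (d⁻¹ k) (by simpa using hk)
    change d (u (d⁻¹ k)) = k
    rw [this]
    simp

/-- This lets the relative norm over `W_{λd ∩ μ}` be treated through one sorted word, that of the
pairs of letters. -/
theorem Triple.stab_eq (t : Triple m n r) : t.stab = wordStab (pairWord t.rowWord t.colWord) := by
  ext u
  rw [Triple.stab, Subgroup.mem_inf, mem_conjBy_young, Lam.young_eq, mem_wordStab, mem_wordStab]
  simp only [pairWord_eq_iff]
  exact ⟨fun h k => ⟨h.2 k, h.1 k⟩, fun h => ⟨fun k => (h k).2, fun k => (h k).1⟩⟩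

theorem swap_apply_of_eq {α : Type*} {c : Fin r → α} {k l : Fin r} (h : c k = c l) (x : Fin r) :
    c (Equiv.swap k l x) = c x := by
  rw [Equiv.swap_apply_def]
  split_ifs with h1 h2
  · rw [h1, h]
  · rw [h2, h]
  · rfl

/-- Minimality of `d⁻¹` for `W_μ` makes `d` increasing on the blocks of `μ`, so `i_λ d` is sorted
there. A repeated pair of opposite parity would put a transposition into one of the two
intersections required to be trivial. -/
theorem Triple.isStandard (t : Triple m n r) : IsStandard t.rowWord t.colWord := by
  obtain ⟨hd, hd', h01, h10⟩ := t.mem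
  rw [Lam.young_eq, mem_distinguished_iff (Lam.monotone_word _), inv_inv] at hd'
  constructor
  · rw [monotone_pairWord_iff]
    refine ⟨t.mu.monotone_word, fun k l hkl he => t.lam.monotone_word ?_⟩
    rcases hkl.lt_or_eq with h | rfl
    · exact (hd' k l h he).le
    · exact le_rfl
  · intro k l hkl he
    rw [pairWord_eq_iff] at he
    obtain ⟨he1, he2⟩ := he
    by_contra hp
    have key : ∀ e e' : ℕ, parity (t.colWord k) = e → parity (t.rowWord k) = e' →
        conjBy (t.lam.youngPart e) t.d ⊓ t.mu.youngPart e' = ⊥ → False := by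
      intro e e' h1 h2 hbot
      have hmem : Equiv.swap k l ∈ conjBy (t.lam.youngPart e) t.d ⊓ t.mu.youngPart e' := by
        refine ⟨mem_conjBy_youngPart.2 ⟨fun x => swap_apply_of_eq (c := t.colWord) he2 x,
          fun x hx => ?_⟩, fun x => swap_apply_of_eq he1 x, fun x hx => ?_⟩
        · apply Equiv.swap_apply_of_ne_of_ne
          · rintro rfl; exact hx h1
          · rintro rfl; exact hx (h1 ▸ congrArg parity he2.symm)
        · apply Equiv.swap_apply_of_ne_of_ne
          · rintro rfl; exact hx h2
          · rintro rfl; exact hx (h2 ▸ congrArg parity he1.symm)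
      rw [hbot, Subgroup.mem_bot, Equiv.swap_eq_one_iff] at hmem
      exact hkl hmem
    rcases parity_cases (t.rowWord k) with ⟨-, h1⟩ | ⟨-, h1⟩ <;>
    rcases parity_cases (t.colWord k) with ⟨-, h2⟩ | ⟨-, h2⟩
    · exact hp (h1.trans h2.symm)
    · exact key 1 0 h2 h1 h10
    · exact key 0 1 h2 h1 h01
    · exact hp (h1.trans h2.symm)

/-- Minimality of `d` for `W_λ` is the stability condition for sorting; hence `d` is determined by
the word `i_λ d`. -/
theorem Triple.inv_d_eq (t : Triple m n r) : t.d⁻¹ = Tuple.sort t.colWord := by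
  have hcomp : t.colWord ∘ (t.d⁻¹ : Equiv.Perm (Fin r)) = t.lam.word := by
    funext x; simp [Triple.colWord]
  have hd := t.mem.1
  rw [Lam.young_eq, mem_distinguished_iff (Lam.monotone_word _)] at hd
  rw [Tuple.eq_sort_iff, hcomp]
  refine ⟨t.lam.monotone_word, fun a b hab he => hd a b hab ?_⟩
  rw [← hcomp]; exact he

theorem Triple.ext_words {t t' : Triple m n r} (h1 : t.rowWord = t'.rowWord)
    (h2 : t.colWord = t'.colWord) : t = t' := by
  have hmu : t.mu = t'.mu := Lam.word_injective h1
  have hd : t.d = t'.d := by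
    rw [← inv_inj, t.inv_d_eq, t'.inv_d_eq, h2]
  have hw : ∀ t : Triple m n r, t.lam.word = t.colWord ∘ (t.d⁻¹ : Equiv.Perm (Fin r)) := by
    intro t; funext x; simp [Triple.colWord]
  have hlam : t.lam = t'.lam := Lam.word_injective (by rw [hw, hw, h2, hd])
  cases t; cases t'
  simp only at hmu hd hlam
  subst hmu hd hlam
  rfl

/-- The composition `λ` comes from sorting `j`, and `d` is the inverse of the stable sorting
permutation. An element of either mixed intersection can move a place only within a repeated pair of
opposite parity, and there is none. -/
theorem IsStandard.exists_triple {i j : Fin r → Fin (m + n)} (h : IsStandard i j) :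
    ∃ t : Triple m n r, t.rowWord = i ∧ t.colWord = j := by
  obtain ⟨hmono, hodd⟩ := h
  rw [monotone_pairWord_iff] at hmono
  obtain ⟨mu, rfl⟩ := exists_word_eq hmono.1
  obtain ⟨lam, hlam⟩ := exists_word_eq (Tuple.monotone_sort j)
  have hj : lam.word ∘ ((Tuple.sort j)⁻¹ : Equiv.Perm (Fin r)) = j := by
    rw [hlam]; funext x; simp
  have hj' : ∀ x, lam.word ((Tuple.sort j)⁻¹ x) = j x := congrFun hj
  have hsort := (Tuple.eq_sort_iff (f := j) (σ := Tuple.sort j)).1 rfl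
  have hbot : ∀ e e' : ℕ, e ≠ e' →
      conjBy (lam.youngPart e) (Tuple.sort j)⁻¹ ⊓ mu.youngPart e' = ⊥ := by
    intro e e' hne
    rw [eq_bot_iff]
    rintro u ⟨hu, hu'⟩
    obtain ⟨h1, h2⟩ := mem_conjBy_youngPart.1 hu
    simp only [hj'] at h1 h2
    rw [Subgroup.mem_bot]
    ext k
    rw [Equiv.Perm.one_apply]
    congr 1
    by_contra hk
    have hp := hodd (u k) k hk (pairWord_eq_iff.2 ⟨hu'.1 k, h1 k⟩)
    rw [hu'.1 k, h1 k] at hp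
    have p1 : parity (j k) = e := by_contra fun h => hk (h2 k h)
    have p2 : parity (mu.word k) = e' := by_contra fun h => hk (hu'.2 k h)
    exact hne (by rw [← p1, ← p2, hp])
  refine ⟨⟨lam, mu, (Tuple.sort j)⁻¹, ?_, ?_, hbot 0 1 (by simp), hbot 1 0 (by simp)⟩, rfl, hj⟩
  · rw [Lam.young_eq, mem_distinguished_iff (Lam.monotone_word _), inv_inv, hlam]
    exact fun a b hab he => hsort.2 a b hab he
  · rw [Lam.young_eq, mem_distinguished_iff (Lam.monotone_word _), inv_inv]
    intro a b hab he
    have hle := hmono.2 a b hab.le he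
    -- A failure forces equal column letters at `a` and `b`, and then the stability of the sort puts
    -- `b` before `a`.
    by_contra hcon
    rw [not_lt] at hcon
    have h3 : (Tuple.sort j)⁻¹ b < (Tuple.sort j)⁻¹ a :=
      lt_of_le_of_ne hcon ((Tuple.sort j)⁻¹.injective.ne hab.ne')
    have h4 := lam.monotone_word h3.le
    rw [hj', hj'] at h4
    have h5 := hsort.2 _ _ h3 (by simpa using le_antisymm h4 hle)
    simp at h5
    exact absurd hab h5.not_gt

end Triples

/-! ### Dual basis, comultiplication and the assembly of the theorem. -/

section Main
variable {F : Type*} [Field F] (q : Fˣ) {m n r : ℕ}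

theorem coef_mul (φ ψ : Module.End F (TensorSpace F m n r)) (i j : Fin r → Fin (m + n)) :
    coef (φ * ψ) i j = ∑ p, coef ψ i p * coef φ p j := by
  rw [coef, Module.End.mul_apply, ← (vBasis F m n r).sum_repr (ψ (vBasis F m n r i))]
  simp only [map_sum, map_smul, Finsupp.finsetSum_apply, Finsupp.smul_apply, smul_eq_mul]
  rfl

theorem neg_one_pow_pairSum_congr {g h : Fin r → Fin r → ℕ}
    (H : ∀ k l, ((g k l : ℕ) : ZMod 2) = h k l) : (-1 : F) ^ pairSum g = (-1) ^ pairSum h := by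
  apply neg_one_pow_eq_of_cast_eq
  simp only [pairSum, Nat.cast_sum, H]

theorem neg_one_pow_pairSum_mul (g h : Fin r → Fin r → ℕ) :
    (-1 : F) ^ pairSum g * (-1) ^ pairSum h = (-1) ^ pairSum (fun k l => g k l + h k l) := by
  rw [pairSum_add, pow_add]

variable (F) in
/-- The sign of `x_{i,p} ⊗ x_{p,j}` in the comultiplication of `x_{i,j}`. -/
def comulSign (i p j : Fin r → Fin (m + n)) : F :=
  (-1) ^ pairSum (fun k l => (parity (p k) + parity (j k)) * (parity (i l) + parity (p l)))

theorem neg_one_pow_pairSum_eq_one {g : Fin r → Fin r → ℕ} (H : ∀ k l, ((g k l : ℕ) : ZMod 2) = 0) :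
    (-1 : F) ^ pairSum g = 1 := by
  rw [neg_one_pow_pairSum_congr (h := fun _ _ => 0) (by simpa using H)]
  simp [pairSum]

theorem sg_self (i : Fin r → Fin (m + n)) : sg F i i = 1 :=
  neg_one_pow_pairSum_eq_one fun k l => by
    push_cast
    linear_combination (parity (i k) : ZMod 2) * parity (i l) * CharTwo.two_eq_zero (R := ZMod 2)

theorem comulSign_left (i j : Fin r → Fin (m + n)) : comulSign F i i j = 1 :=
  neg_one_pow_pairSum_eq_one fun k l => by
    push_cast
    linear_combination ((parity (i k) : ZMod 2) + parity (j k)) * parity (i l) *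
      CharTwo.two_eq_zero (R := ZMod 2)

theorem comulSign_right (i j : Fin r → Fin (m + n)) : comulSign F i j j = 1 :=
  neg_one_pow_pairSum_eq_one fun k l => by
    push_cast
    linear_combination ((parity (i l) : ZMod 2) + parity (j l)) * parity (j k) *
      CharTwo.two_eq_zero (R := ZMod 2)

/-- The comultiplication sign is the coboundary of `sg`: after the twist by `sg` the
comultiplication is dual to plain matrix multiplication. The identity holds for each pair of places
separately, as one between bits. -/
theorem sg_mul_sg (i p j : Fin r → Fin (m + n)) :
    sg F i p * sg F p j = sg F i j * comulSign F i p j := by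
  rw [sg, sg, sg, comulSign, neg_one_pow_pairSum_mul, neg_one_pow_pairSum_mul]
  refine neg_one_pow_pairSum_congr fun k l => ?_
  push_cast
  generalize (parity (i l) : ZMod 2) = a
  generalize (parity (p k) : ZMod 2) = b
  generalize (parity (p l) : ZMod 2) = c
  generalize (parity (j k) : ZMod 2) = d
  generalize (parity (j l) : ZMod 2) = e
  revert a b c d e
  decide

/-- The cocycle identity behind coassociativity. -/
theorem comulSign_mul_comulSign (i p s j : Fin r → Fin (m + n)) :
    comulSign F i p j * comulSign F i s p = comulSign F i s j * comulSign F s p j := by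
  rw [comulSign, comulSign, comulSign, comulSign, neg_one_pow_pairSum_mul,
    neg_one_pow_pairSum_mul]
  refine neg_one_pow_pairSum_congr fun k l => ?_
  push_cast
  linear_combination ((parity (p k) : ZMod 2) * parity (i l) - parity (j k) * parity (s l)) *
    CharTwo.two_eq_zero (R := ZMod 2)

/-- The functional is the preimage of the relative norm under `dualAct`; its values on standard
monomials are the entries computed in `coef_relNorm`, up to `sg`. -/
theorem exists_dual_family (hq2 : (q : F) + (q : F)⁻¹ ≠ 0) (t : Triple m n r) :
    ∃ f : Module.Dual F (QMat.homog q m n r),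
      dualAct q m n r f = relNorm q t.stab (matUnit F t.rowWord t.colWord) ∧
      f (xMono q t.rowWord t.colWord) = sg F t.rowWord t.colWord ∧
      ∀ t' : Triple m n r, t' ≠ t → f (xMono q t'.rowWord t'.colWord) = 0 := by
  have hmem := relNorm_matUnit_mem q t.isStandard
  rw [← t.stab_eq, ← Subalgebra.mem_toSubmodule, ← range_dualAct q hq2] at hmem
  obtain ⟨f, hf⟩ := hmem
  have hc : ∀ t' : Triple m n r, f (xMono q t'.rowWord t'.colWord) =
      sg F t'.rowWord t'.colWord *
        if t'.rowWord = t.rowWord ∧ t'.colWord = t.colWord then 1 else 0 := by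
    intro t'
    rw [← coef_relNorm q t.isStandard t'.isStandard, ← t.stab_eq, ← hf, coef_dualAct, ← mul_assoc,
      sg_mul_self, one_mul]
  refine ⟨f, hf, by simp [hc], fun t' hne => ?_⟩
  rw [hc, if_neg (fun h => hne (Triple.ext_words h.1 h.2)), mul_zero]

theorem eq_zero_of_forall_triple (hq2 : (q : F) + (q : F)⁻¹ ≠ 0)
    {f : Module.Dual F (QMat.homog q m n r)}
    (hf : ∀ t : Triple m n r, f (xMono q t.rowWord t.colWord) = 0) : f = 0 := by
  have ha := (mem_schurSuper_iff_coef q).1 (dualAct_mem q f)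
  refine dualAct_injective q (coef_ext fun i j => ?_)
  rw [ha.eq_zero q hq2 (fun i j h => ?_) i j, map_zero]
  · simp [coef]
  · obtain ⟨t, rfl, rfl⟩ := h.exists_triple
    rw [coef_dualAct, hf, mul_zero]

/-- Negation is the scalar `-1`, so the addition and scalar action of the statement stay as they
are. -/
instance : AddCommGroup (QMat.homog q m n r) := Module.addCommMonoidToAddCommGroup F

/-- Independence comes from the dual family. Spanning holds because a functional killing all
standard monomials corresponds to a commuting matrix vanishing at all standard pairs. -/
theorem exists_basis (hq2 : (q : F) + (q : F)⁻¹ ≠ 0) :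
    ∃ b : Module.Basis (Triple m n r) F (QMat.homog q m n r),
      (∀ t, b t = xMono q t.rowWord t.colWord) ∧
      ∀ t, relNorm q t.stab (matUnit F t.rowWord t.colWord) =
        sg F t.rowWord t.colWord • dualAct q m n r (b.coord t) := by
  choose f hf hf1 hf0 using exists_dual_family q hq2 (m := m) (n := n) (r := r)
  have hli : LinearIndependent F fun t : Triple m n r => xMono q t.rowWord t.colWord := by
    rw [linearIndependent_iff']
    intro s g hg t ht
    have := congrArg (f t) hg
    rw [map_sum, Finset.sum_eq_single t (fun t' _ hne => by rw [map_smul, hf0 t t' hne, smul_zero])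
      (fun h => absurd ht h), map_smul, hf1, map_zero, smul_eq_mul] at this
    exact (mul_eq_zero.1 this).resolve_right
      (left_ne_zero_of_mul (sg_mul_self (F := F) t.rowWord t.colWord ▸ one_ne_zero))
  have hsp : ⊤ ≤ Submodule.span F
      (Set.range fun t : Triple m n r => xMono q t.rowWord t.colWord) := by
    by_contra hcon
    obtain ⟨g, hg, hle⟩ := Submodule.exists_le_ker_of_lt_top _ (lt_top_iff_ne_top.2
      fun h => hcon h.ge)
    exact hg (eq_zero_of_forall_triple q hq2 fun t =>
      LinearMap.mem_ker.1 (hle (Submodule.subset_span ⟨t, rfl⟩)))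
  refine ⟨Module.Basis.mk hli hsp, fun t => Module.Basis.mk_apply hli hsp t, fun t => ?_⟩
  have hcoord : (Module.Basis.mk hli hsp).coord t = sg F t.rowWord t.colWord • f t := by
    refine (Module.Basis.mk hli hsp).ext fun t' => ?_
    rw [Module.Basis.coord_apply, Module.Basis.repr_self, LinearMap.smul_apply,
      Module.Basis.mk_apply, smul_eq_mul]
    by_cases h : t' = t
    · subst h
      rw [Finsupp.single_eq_same, hf1, sg_mul_self]
    · rw [hf0 t t' h, mul_zero, Finsupp.single_eq_of_ne (Ne.symm h)]
  rw [hcoord, map_smul, smul_smul, sg_mul_self, one_smul, hf]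

/-- A family of vectors defines a linear map on the homogeneous component if this holds after
pairing with the coordinates of some basis of the target. -/
theorem exists_linearMap (hq2 : (q : F) + (q : F)⁻¹ ≠ 0) {M ι : Type*} [AddCommMonoid M] [Module F M]
    (e : Module.Basis ι F M) (y : (Fin r → Fin (m + n)) → (Fin r → Fin (m + n)) → M)
    (hy : ∀ s, ∃ f : Module.Dual F (QMat.homog q m n r), ∀ i j, f (xMono q i j) = e.coord s (y i j)) :
    ∃ D : QMat.homog q m n r →ₗ[F] M, ∀ i j, D (xMono q i j) = y i j := by
  obtain ⟨b, hb, -⟩ := exists_basis q hq2 (m := m) (n := n) (r := r)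
  refine ⟨b.constr F fun t => y t.rowWord t.colWord, fun i j => e.ext_elem fun s => ?_⟩
  obtain ⟨f, hf⟩ := hy s
  have : e.coord s ∘ₗ b.constr F (fun t => y t.rowWord t.colWord) = f :=
    b.ext fun t => by
      rw [LinearMap.comp_apply, Module.Basis.constr_basis, ← hf, hb]
  have h := LinearMap.congr_fun this (xMono q i j)
  rw [hf] at h
  exact h

/-- The product formula respects the relations because it is realized by the composite of two
commuting operators. `g` stands on the left since `f` acts first. -/
theorem exists_functional_mul (hq2 : (q : F) + (q : F)⁻¹ ≠ 0)
    (f g : Module.Dual F (QMat.homog q m n r)) :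
    ∃ h : Module.Dual F (QMat.homog q m n r), ∀ i j, h (xMono q i j) =
      ∑ p, comulSign F i p j * (f (xMono q i p) * g (xMono q p j)) := by
  have hmem := mul_mem (dualAct_mem q g) (dualAct_mem q f)
  rw [← Subalgebra.mem_toSubmodule, ← range_dualAct q hq2] at hmem
  obtain ⟨h, hh⟩ := hmem
  refine ⟨h, fun i j => ?_⟩
  have e := congrArg (fun φ => sg F i j * coef φ i j) hh
  simp only [coef_mul, coef_dualAct, ← mul_assoc, sg_mul_self, one_mul] at e
  rw [e, Finset.mul_sum]
  refine Finset.sum_congr rfl fun p _ => ?_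
  have e1 := sg_mul_sg (F := F) i p j
  have e2 := sg_mul_self (F := F) i j
  linear_combination sg F i j * f (xMono q i p) * g (xMono q p j) * e1 +
    comulSign F i p j * f (xMono q i p) * g (xMono q p j) * e2

/-- The coordinates of the target with respect to `b ⊗ b` are tensor products of coordinate
functionals, so each one is an instance of `exists_functional_mul`. -/
theorem exists_comul (hq2 : (q : F) + (q : F)⁻¹ ≠ 0) :
    ∃ D : QMat.homog q m n r →ₗ[F] QMat.homog q m n r ⊗[F] QMat.homog q m n r,
      ∀ i j, D (xMono q i j) =
        ∑ p, comulSign F i p j • (xMono q i p ⊗ₜ[F] xMono q p j) := by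
  obtain ⟨b, -⟩ := exists_basis q hq2 (m := m) (n := n) (r := r)
  refine exists_linearMap q hq2 (b.tensorProduct b) _ fun s => ?_
  obtain ⟨h, hh⟩ := exists_functional_mul q hq2 (b.coord s.1) (b.coord s.2)
  refine ⟨h, fun i j => ?_⟩
  rw [hh, map_sum]
  refine Finset.sum_congr rfl fun p _ => ?_
  obtain ⟨s1, s2⟩ := s
  simp [mul_comm]

theorem exists_counit (hq2 : (q : F) + (q : F)⁻¹ ≠ 0) :
    ∃ ε : Module.Dual F (QMat.homog q m n r), dualAct q m n r ε = 1 ∧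
      ∀ i j, ε (xMono q i j) = if i = j then 1 else 0 := by
  have hmem := one_mem (schurSuper q m n r)
  rw [← Subalgebra.mem_toSubmodule, ← range_dualAct q hq2] at hmem
  obtain ⟨ε, hε⟩ := hmem
  refine ⟨ε, hε, fun i j => ?_⟩
  have e := congrArg (fun φ => sg F i j * coef φ i j) hε
  simp only [coef_dualAct, ← mul_assoc, sg_mul_self, one_mul] at e
  rw [e, coef, Module.End.one_apply, Module.Basis.repr_self, Finsupp.single_apply]
  split_ifs with h
  · rw [h, sg_self, mul_one]
  · rw [mul_zero]

/-- The product is reversed in the last clause because endomorphisms of the statement compose on the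
right, while `*` here composes on the left. -/
theorem exists_coalgebra (hq2 : (q : F) + (q : F)⁻¹ ≠ 0) :
    ∃ C : Coalgebra F (QMat.homog q m n r), IsMatCoalgebra q m n r C ∧
      dualAct q m n r C.counit = 1 ∧
      ∀ f g : Module.Dual F (QMat.homog q m n r),
        dualAct q m n r (LinearMap.mul' F F ∘ₗ TensorProduct.map f g ∘ₗ C.comul) =
          dualAct q m n r g * dualAct q m n r f := by
  obtain ⟨D, hD⟩ := exists_comul q hq2 (m := m) (n := n) (r := r)
  obtain ⟨ε, hε1, hε⟩ := exists_counit q hq2 (m := m) (n := n) (r := r)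
  let C : Coalgebra F (QMat.homog q m n r) :=
    { comul := D
      counit := ε
      coassoc := by
        refine dual_ext q fun i j => ?_
        simp only [LinearMap.comp_apply, LinearEquiv.coe_coe, hD, map_sum, map_smul,
          LinearMap.rTensor_tmul, LinearMap.lTensor_tmul, TensorProduct.sum_tmul,
          TensorProduct.tmul_sum, ← TensorProduct.smul_tmul', TensorProduct.tmul_smul,
          TensorProduct.assoc_tmul, Finset.smul_sum, smul_smul]
        rw [Finset.sum_comm]
        refine Finset.sum_congr rfl fun s _ => Finset.sum_congr rfl fun p _ => ?_
        rw [comulSign_mul_comulSign]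
      rTensor_counit_comp_comul := by
        refine dual_ext q fun i j => ?_
        simp only [LinearMap.comp_apply, hD, map_sum, map_smul, LinearMap.rTensor_tmul, hε]
        rw [Finset.sum_eq_single i]
        · simp [comulSign_left]
        · intro p _ hp
          simp [hp.symm]
        · simp
      lTensor_counit_comp_comul := by
        refine dual_ext q fun i j => ?_
        simp only [LinearMap.comp_apply, hD, map_sum, map_smul, LinearMap.lTensor_tmul, hε]
        rw [Finset.sum_eq_single j]
        · simp [comulSign_right]
        · intro p _ hp
          simp [hp]
        · simp }
  refine ⟨C, ⟨hD, hε⟩, hε1, fun f g => coef_ext fun i j => ?_⟩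
  have hC : C.comul (xMono q i j) = _ := hD i j
  rw [coef_dualAct, coef_mul, LinearMap.comp_apply, LinearMap.comp_apply, hC]
  simp only [map_sum, map_smul, TensorProduct.map_tmul, LinearMap.mul'_apply, Finset.mul_sum,
    coef_dualAct, smul_eq_mul]
  refine Finset.sum_congr rfl fun p _ => ?_
  have e1 := sg_mul_sg (F := F) i p j
  linear_combination - f (xMono q i p) * g (xMono q p j) * e1

/-- Otherwise `q² = -1`, and raising to the odd power `l` gives `1 = -1`. -/
theorem add_inv_ne_zero_of_odd [CharZero F] {l : ℕ} (hl : Odd l)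
    (hq : IsPrimitiveRoot (q : F) l) : (q : F) + (q : F)⁻¹ ≠ 0 := by
  intro h
  have hq0 : (q : F) ≠ 0 := q.ne_zero
  have h2 : (q : F) ^ 2 = -1 := by
    field_simp at h
    linear_combination h
  have h4 : ((q : F) ^ 2) ^ l = 1 := by rw [← pow_mul, mul_comm, pow_mul, hq.pow_eq_one, one_pow]
  rw [h2, hl.neg_one_pow] at h4
  norm_num at h4

end Main

end QSuper

end

theorem theorem8p3 {F : Type*} [Field F] [CharZero F] (q : Fˣ) (l : ℕ) (hl : Odd l)
    (hq : IsPrimitiveRoot (q : F) l) (m n r : ℕ) :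
    -- the identification of the `q`-Schur superalgebra with the dual of `𝒜_q(m|n, r)`
    (∃ C : Coalgebra F (QMat.homog q m n r), IsMatCoalgebra q m n r C ∧
      dualAct q m n r C.counit = 1 ∧
      ∀ f g : Module.Dual F (QMat.homog q m n r),
        dualAct q m n r (LinearMap.mul' F F ∘ₗ TensorProduct.map f g ∘ₗ C.comul) =
          dualAct q m n r g * dualAct q m n r f) ∧
    Function.Injective (dualAct q m n r) ∧
    LinearMap.range (dualAct q m n r) = Subalgebra.toSubmodule (schurSuper q m n r) ∧
    -- the monomials `x_{μ,λd}` form a basis, and the relative norms are its dual basis up to sign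
    ∃ b : Module.Basis (Triple m n r) F (QMat.homog q m n r),
      (∀ t, b t = xMono q t.rowWord t.colWord) ∧
      ∀ t, relNorm q t.stab (matUnit F t.rowWord t.colWord) =
        (-1 : F) ^ pairSum (fun k k' => parity (t.colWord k) *
            (parity (t.colWord k') + parity (t.rowWord k'))) •
          dualAct q m n r (b.coord t) := by
  have hq2 := add_inv_ne_zero_of_odd q hl hq
  exact ⟨exists_coalgebra q hq2, dualAct_injective q, range_dualAct q hq2, exists_basis q hq2⟩
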